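/- Let $p_1,\dots,p_t$ be pairwise distinct odd primes, let $r_1,\dots,r_t\ge 1$, and put $m_j=p_j^{r_j}$, $q=m_1\cdots m_t$, $n_j=m_1+\cdots+m_j$ (so $n_0=0$) and $n=n_t$. Let $B_n$ be the Artin braid group with its standard generators $\sigma_1,\dots,\sigma_{n-1}$, let $P_n$ be the pure braid group, i.e. the kernel of the homomorphism $B_n\to S_n$, $\sigma_i\mapsto (i,\,i+1)$, and work in the group $B_n/[P_n,P_n]$. There put $$A_{i,j}=\sigma_{j-1}\cdots\sigma_{i+1}\,\sigma_i^2\,\sigma_{i+1}^{-1}\cdots\sigma_{j-1}^{-1}\qquad(1\le i<j\le n),$$ $$\delta_{a,m}=\sigma_{a+m-1}\cdots\sigma_{a+\frac{m+1}{2}}\;\sigma_{a+\frac{m-1}{2}}^{-1}\cdots\sigma_{a+1}^{-1}\quad(m\text{ odd}),\qquad \delta=\delta_{n_0,m_1}\,\delta_{n_1,m_2}\cdots\delta_{n_{t-1},m_t}.$$ Let $\Gamma_q$ be the subgroup of $B_n/[P_n,P_n]$ generated by the elements $A_{n_{j-1}+1,\,n_{j-1}+2}\,\delta_{n_{j-1},m_j}$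 for $1\le j\le t$ and the elements $A_{r,s}^{\,q}$ for $1\le r<s\le n$. Define - $e_{j,0,1}=\bigl(A_{n_{j-1}+1,\,n_{j-1}+2}\,\delta_{n_{j-1},m_j}\bigr)^{m_j}$ for $1\le j\le t$; - $e_{j,h,k}=\delta^{k-1}A_{n_{j-1}+1,\,n_{j-1}+h+2}^{\,q}\,\delta^{-(k-1)}$ for $1\le j\le t$, $1\le h\le \frac{m_j-3}{2}$, $1\le k\le m_j$; - $e_{t+j,\,t+l,\,k}=\delta^{k-1}A_{n_{j-1}+1,\,n_{l-1}+1}^{\,q}\,\delta^{-(k-1)}$ for $1\le j<l\le t$, $1\le k\le m_jm_l$. Then the center of $\Gamma_q$ is a free abelian group of rank $$\sum_{i=1}^t\frac{p_i^{r_i}-1}{2}+\frac{t(t-1)}{2},$$ and a basis of it is given by the elements $e_{j,0,1}$ $(1\le j\le t)$, the elements $\prod_{k=1}^{m_j}e_{j,h,k}$ $(1\le j\le t,\ 1\le h\le\frac{m_j-3}{2})$ and the elements $\prod_{k=1}^{m_jm_l}e_{t+j,\,t+l,\,k}$ $(1\le j<l\le t)$, where the members of this family, indexed as shown, are pairwise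 distinct. -/

import Mathlib

open scoped BigOperators IsMulCommutative

/-- The relators of the Artin presentation on `n` strings. The free generator with index
`i : Fin (n - 1)` (counted from `0`) is `σ_{i+1}`. -/
def braidRels (n : ℕ) : Set (FreeGroup (Fin (n - 1))) :=
  {w | ∃ i j : Fin (n - 1), (i : ℕ) + 2 ≤ (j : ℕ) ∧
      w = (FreeGroup.of i * FreeGroup.of j) * (FreeGroup.of j * FreeGroup.of i)⁻¹} ∪
  {w | ∃ i j : Fin (n - 1), (j : ℕ) = (i : ℕ) + 1 ∧
      w = (FreeGroup.of j * FreeGroup.of i * FreeGroup.of j) *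
        (FreeGroup.of i * FreeGroup.of j * FreeGroup.of i)⁻¹}

/-- The Artin braid group `B_n`. -/
abbrev BraidGroup (n : ℕ) : Type := PresentedGroup (braidRels n)

/-- The transposition of the two strings crossed by a generator of `B_n`. -/
def braidSwap (n : ℕ) (i : Fin (n - 1)) : Equiv.Perm (Fin n) :=
  Equiv.swap ⟨i, by omega⟩ ⟨i + 1, by omega⟩

theorem braidSwap_rels (n : ℕ) :
    ∀ w ∈ braidRels n, FreeGroup.lift (braidSwap n) w = 1 := by
  rintro w (⟨i, j, hij, rfl⟩ | ⟨i, j, hij, rfl⟩)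
  · simp only [map_mul, map_inv, FreeGroup.lift_apply_of, mul_inv_eq_one]
    ext x
    simp only [braidSwap, Equiv.Perm.mul_apply, Equiv.swap_apply_def, Fin.ext_iff]
    grind
  · simp only [map_mul, map_inv, FreeGroup.lift_apply_of, mul_inv_eq_one]
    ext x
    simp only [braidSwap, Equiv.Perm.mul_apply, Equiv.swap_apply_def, Fin.ext_iff]
    grind

/-- The homomorphism `B_n → S_n` sending `σ_i` to the transposition `(i, i + 1)`. -/
def braidPerm (n : ℕ) : BraidGroup n →* Equiv.Perm (Fin n) :=
  PresentedGroup.toGroup (braidSwap_rels n)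

/-- The pure braid group `P_n`, as a subgroup of `B_n`. -/
def pureBraid (n : ℕ) : Subgroup (BraidGroup n) := (braidPerm n).ker

instance pureBraid_normal (n : ℕ) : (pureBraid n).Normal :=
  inferInstanceAs (braidPerm n).ker.Normal

/-- The quotient `B_n / [P_n, P_n]`. -/
abbrev BraidQuot (n : ℕ) : Type := BraidGroup n ⧸ ⁅pureBraid n, pureBraid n⁆

/-- The class of `σ_i` in `B_n / [P_n, P_n]`, for `1 ≤ i ≤ n - 1` (and `1` for other `i`,
which never occur below). -/
def sigmaQ (n i : ℕ) : BraidQuot n :=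
  if h : 1 ≤ i ∧ i ≤ n - 1 then
    QuotientGroup.mk (PresentedGroup.of (⟨i - 1, by omega⟩ : Fin (n - 1)))
  else 1

/-- The class of `A_{i,j} = σ_{j-1} ⋯ σ_{i+1} σ_i² σ_{i+1}⁻¹ ⋯ σ_{j-1}⁻¹`, for
`1 ≤ i < j ≤ n`. -/
def pureA (n i j : ℕ) : BraidQuot n :=
  ((List.range (j - i - 1)).map fun s => sigmaQ n (j - 1 - s)).prod * sigmaQ n i ^ 2 *
    (((List.range (j - i - 1)).map fun s => sigmaQ n (j - 1 - s)).prod)⁻¹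

/-- The class of `δ_{a,m} = σ_{a+m-1} ⋯ σ_{a+(m+1)/2} σ_{a+(m-1)/2}⁻¹ ⋯ σ_{a+1}⁻¹`, for odd
`m` and `a + m ≤ n`. -/
def deltaBlock (n a m : ℕ) : BraidQuot n :=
  ((List.range ((m - 1) / 2)).map fun s => sigmaQ n (a + m - 1 - s)).prod *
    ((List.range ((m - 1) / 2)).map fun s => (sigmaQ n (a + (m - 1) / 2 - s))⁻¹).prod

section Blocks

/-- The number of strings `n = m_1 + ⋯ + m_t` for block sizes `m_1, …, m_t`. -/
def numStrings {t : ℕ} (m : Fin t → ℕ) : ℕ := ∑ i, m i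

/-- The number of strings in the blocks before the block `j`. -/
def blockStart {t : ℕ} (m : Fin t → ℕ) (j : Fin t) : ℕ := ∑ i ∈ Finset.Iio j, m i

/-- The product `q` of the block sizes. -/
def holonomyOrder {t : ℕ} (m : Fin t → ℕ) : ℕ := ∏ i, m i

/-- The product over all blocks, in increasing order, of the elements `δ_{a,m}`. -/
def deltaAll {t : ℕ} (m : Fin t → ℕ) : BraidQuot (numStrings m) :=
  (List.ofFn fun j : Fin t => deltaBlock (numStrings m) (blockStart m j) (m j)).prod

/-- The element `A_{a+1,a+2} δ_{a,m_j}`, where `a` strings precede the block `j`. -/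
def blockGen {t : ℕ} (m : Fin t → ℕ) (j : Fin t) : BraidQuot (numStrings m) :=
  pureA (numStrings m) (blockStart m j + 1) (blockStart m j + 2) *
    deltaBlock (numStrings m) (blockStart m j) (m j)

/-- The group `Γ_q`: the subgroup of `B_n / [P_n, P_n]` generated by the elements `blockGen`
and by the powers `A_{r,s}^q`, `1 ≤ r < s ≤ n`. -/
def GammaQ {t : ℕ} (m : Fin t → ℕ) : Subgroup (BraidQuot (numStrings m)) :=
  Subgroup.closure
    (Set.range (blockGen m) ∪
      {x | ∃ r s : ℕ, 1 ≤ r ∧ r < s ∧ s ≤ numStrings m ∧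
        x = pureA (numStrings m) r s ^ holonomyOrder m})

/-- The element `e_{j,0,1}`. -/
def eFixed {t : ℕ} (m : Fin t → ℕ) (j : Fin t) : BraidQuot (numStrings m) :=
  blockGen m j ^ m j

/-- The elements `e_{j,h,k}` for a block `j`, with `1 ≤ h ≤ (m_j - 3) / 2` and
`1 ≤ k ≤ m_j`. -/
def eBlock {t : ℕ} (m : Fin t → ℕ) (j : Fin t) (h k : ℕ) : BraidQuot (numStrings m) :=
  deltaAll m ^ (k - 1) *
    pureA (numStrings m) (blockStart m j + 1) (blockStart m j + h + 2) ^ holonomyOrder m *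
    (deltaAll m ^ (k - 1))⁻¹

/-- The elements `e_{t+j,t+l,k}` for two blocks `j < l`, with `1 ≤ k ≤ m_j m_l`. -/
def eCross {t : ℕ} (m : Fin t → ℕ) (j l : Fin t) (k : ℕ) : BraidQuot (numStrings m) :=
  deltaAll m ^ (k - 1) *
    pureA (numStrings m) (blockStart m j + 1) (blockStart m l + 1) ^ holonomyOrder m *
    (deltaAll m ^ (k - 1))⁻¹

/-- The index set of the orbits: the blocks `j`, the pairs `(j, h)` with
`1 ≤ h ≤ (m_j - 3) / 2`, and the pairs of blocks `j < l`. -/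
abbrev OrbitIndex {t : ℕ} (m : Fin t → ℕ) : Type :=
  Fin t ⊕ (Σ j : Fin t, Finset.Icc 1 ((m j - 3) / 2)) ⊕ {x : Fin t × Fin t // x.1 < x.2}

/-- The product of the elements of each orbit, in increasing order of `k`. -/
def orbitProd {t : ℕ} (m : Fin t → ℕ) : OrbitIndex m → BraidQuot (numStrings m)
  | Sum.inl j => eFixed m j
  | Sum.inr (Sum.inl x) => ((List.range' 1 (m x.1)).map fun k => eBlock m x.1 x.2 k).prod
  | Sum.inr (Sum.inr x) =>
      ((List.range' 1 (m x.1.1 * m x.1.2)).map fun k => eCross m x.1.1 x.1.2 k).prod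

end Blocks

/-!
Recording, besides the permutation of a braid, the signed number of crossings of each pair of
strings embeds `B_n / [P_n, P_n]` into the group of pairs of a permutation and an integer function
on pairs of strings: modulo the `A_{r,s}` the Artin generators satisfy the Coxeter relations, so the
`A_{r,s}` generate `P_n / [P_n, P_n]`, and their crossing numbers are twice the indicator functions
of the single pairs.

Label the strings by their block and their position modulo `m_j`. After a correction by a
coboundary, `δ` has no crossings and translates all positions by `-1`; by the Chinese remainder
theorem its powers realise all translations. The powers `A_{r,s}^q` force the permutation of a
central element of `Γ_q` to be trivial, so the central elements are the pure elements of `Γ_q` whose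
crossing numbers are invariant under all translations. Such an element is determined by one value
on each orbit of pairs of strings, which is a multiple of `2` if the orbit consists of cyclically
adjacent strings of a block and of `2q` otherwise, and the product over an orbit attains this
minimal value on its orbit and vanishes on the others.
-/

/-- The semidirect product of the permutations of `α` with the functions `Sym2 α → ℤ`. An element
is thought of as a braid with strands `α`, of which only the permutation and the signed number of
crossings of each pair of strands are remembered; strands are labelled by their starting points,
and `g * h` runs through `h` first. -/
@[ext]
structure CrossingGroup (α : Type*) where
  perm : Equiv.Perm α
  cr : Sym2 α → ℤ

namespace CrossingGroup

variable {α β : Type*}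

instance : Mul (CrossingGroup α) :=
  ⟨fun g h => ⟨g.perm * h.perm, fun e => g.cr (e.map h.perm) + h.cr e⟩⟩

instance : One (CrossingGroup α) := ⟨⟨1, 0⟩⟩

instance : Inv (CrossingGroup α) := ⟨fun g => ⟨g.perm⁻¹, fun e => -g.cr (e.map ⇑g.perm⁻¹)⟩⟩

@[simp] theorem mul_perm (g h : CrossingGroup α) : (g * h).perm = g.perm * h.perm := rfl

@[simp] theorem mul_cr (g h : CrossingGroup α) (e : Sym2 α) :
    (g * h).cr e = g.cr (e.map h.perm) + h.cr e := rfl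

@[simp] theorem one_perm : (1 : CrossingGroup α).perm = 1 := rfl

@[simp] theorem one_cr (e : Sym2 α) : (1 : CrossingGroup α).cr e = 0 := rfl

@[simp] theorem inv_perm (g : CrossingGroup α) : g⁻¹.perm = g.perm⁻¹ := rfl

@[simp] theorem inv_cr (g : CrossingGroup α) (e : Sym2 α) :
    g⁻¹.cr e = -g.cr (e.map ⇑g.perm⁻¹) := rfl

instance : Group (CrossingGroup α) :=
  Group.ofLeftAxioms
    (fun _ _ _ => by ext <;> simp [Sym2.map_map, add_assoc])
    (fun _ => by ext <;> simp)
    (fun _ => by ext <;> simp [Sym2.map_map])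

/-- The projection to the underlying permutation. -/
@[simps]
def permHom (α : Type*) : CrossingGroup α →* Equiv.Perm α where
  toFun := perm
  map_one' := rfl
  map_mul' _ _ := rfl

@[simp] theorem pow_perm (g : CrossingGroup α) (k : ℕ) : (g ^ k).perm = g.perm ^ k :=
  map_pow (permHom α) g k

theorem pow_cr (g : CrossingGroup α) (k : ℕ) (e : Sym2 α) :
    (g ^ k).cr e = ∑ i ∈ Finset.range k, g.cr (e.map ⇑(g.perm ^ i)) := by
  induction k with
  | zero => simp
  | succ k ih => rw [pow_succ', mul_cr, pow_perm, ih, Finset.sum_range_succ, add_comm]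

theorem commute_of_perm_eq_one {g h : CrossingGroup α} (hg : g.perm = 1) (hh : h.perm = 1) :
    Commute g h := by
  ext <;> simp [hg, hh, add_comm]

theorem conj_perm {g : CrossingGroup α} (hg : g.perm = 1) (h : CrossingGroup α) :
    (h * g * h⁻¹).perm = 1 := by
  simp [hg]

theorem conj_cr {g : CrossingGroup α} (hg : g.perm = 1) (h : CrossingGroup α) (e : Sym2 α) :
    (h * g * h⁻¹).cr e = g.cr (e.map ⇑h.perm⁻¹) := by
  simp [hg, Sym2.map_map]

theorem commute_iff {g : CrossingGroup α} (hg : g.perm = 1) (h : CrossingGroup α) :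
    Commute h g ↔ ∀ e, g.cr (e.map h.perm) = g.cr e := by
  rw [commute_iff_eq, CrossingGroup.ext_iff, funext_iff]
  simp [hg, add_comm (h.cr _), eq_comm]

theorem conj_eq_conj_of_perm_eq {g h h' : CrossingGroup α} (hg : g.perm = 1)
    (hh : h.perm = h'.perm) : h * g * h⁻¹ = h' * g * h'⁻¹ :=
  CrossingGroup.ext ((conj_perm hg h).trans (conj_perm hg h').symm)
    (funext fun e => by rw [conj_cr hg, conj_cr hg, hh])

theorem list_range_map_prod (f : ℕ → Sym2 α → ℤ) (N : ℕ) :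
    ((List.range N).map fun k => (⟨1, f k⟩ : CrossingGroup α)).prod =
      ⟨1, fun e => ∑ k ∈ Finset.range N, f k e⟩ := by
  induction N with
  | zero => rfl
  | succ N ih =>
    rw [List.range_succ, List.map_append, List.prod_append, ih]
    refine CrossingGroup.ext (one_mul _) (funext fun e => ?_)
    simp [Finset.sum_range_succ]

/-- Relabelling of the strands. -/
@[simps]
def congr (f : α ≃ β) : CrossingGroup α ≃* CrossingGroup β where
  toFun g := ⟨f.permCongr g.perm, fun e => g.cr (e.map f.symm)⟩
  invFun g := ⟨f.symm.permCongr g.perm, fun e => g.cr (e.map f)⟩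
  left_inv g := by ext <;> simp [Sym2.map_map]
  right_inv g := by ext <;> simp [Sym2.map_map]
  map_mul' g h := by
    ext e
    · simp
    · simp [Sym2.map_map, Function.comp_def]

variable [DecidableEq α]

/-- The two strands at `x` and `y` cross once, with sign `ε`. -/
@[simps]
def crossing (ε : ℤ) (x y : α) : CrossingGroup α := ⟨Equiv.swap x y, Pi.single s(x, y) ε⟩

theorem single_map_perm (e e' : Sym2 α) (c : ℤ) (π : Equiv.Perm α) :
    (Pi.single e c : Sym2 α → ℤ) (e'.map π) = (Pi.single (e.map ⇑π⁻¹) c : Sym2 α → ℤ) e' := by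
  have h : e'.map π = e ↔ e' = e.map ⇑π⁻¹ := by
    rw [← (Sym2.map.injective π.injective).eq_iff (b := e.map ⇑π⁻¹)]
    simp [Sym2.map_map]
  simp only [Pi.single_apply, h]

theorem mk_single_pow (e : Sym2 α) (c : ℤ) (k : ℕ) :
    (⟨1, Pi.single e c⟩ : CrossingGroup α) ^ k = ⟨1, Pi.single e (c * k)⟩ := by
  refine CrossingGroup.ext (by rw [pow_perm, one_pow]) (funext fun e' => ?_)
  simp [pow_cr, Pi.single_apply, mul_comm]

theorem crossing_inv (ε : ℤ) (x y : α) : (crossing ε x y)⁻¹ = crossing (-ε) x y := by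
  ext e
  · simp
  · simp [single_map_perm, Sym2.eq_swap (a := y), Pi.single_neg]

theorem crossing_comm {x y z w : α} (hxz : x ≠ z) (hxw : x ≠ w) (hyz : y ≠ z) (hyw : y ≠ w)
    (ε ε' : ℤ) : Commute (crossing ε x y) (crossing ε' z w) := by
  ext e
  · simp only [mul_perm, crossing_perm]
    rw [Equiv.mul_swap_eq_swap_mul, Equiv.swap_apply_of_ne_of_ne hxz.symm hyz.symm,
      Equiv.swap_apply_of_ne_of_ne hxw.symm hyw.symm]
  · simp [single_map_perm, Equiv.swap_apply_of_ne_of_ne, hxz, hxw, hyz, hyw, hxz.symm, hxw.symm,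
      hyz.symm, hyw.symm, add_comm]

theorem crossing_braid {x y z : α} (hxy : x ≠ y) (hxz : x ≠ z) (hyz : y ≠ z) (ε : ℤ) :
    crossing ε x y * crossing ε y z * crossing ε x y =
      crossing ε y z * crossing ε x y * crossing ε y z := by
  ext e
  · simp only [mul_perm, crossing_perm]
    rw [Equiv.swap_mul_swap_mul_swap hxy hxz, Equiv.swap_comm x y, Equiv.swap_comm y z,
      Equiv.swap_mul_swap_mul_swap hyz.symm hxz.symm, Equiv.swap_comm]
  · simp only [mul_cr, crossing_cr, crossing_perm, single_map_perm, Equiv.swap_inv, Sym2.map_mk,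
      Equiv.swap_apply_left, Equiv.swap_apply_right,
      Equiv.swap_apply_of_ne_of_ne hxz.symm hyz.symm, Equiv.swap_apply_of_ne_of_ne hxy hxz]
    ring

end CrossingGroup

open CrossingGroup

section Crossings

variable {n : ℕ}

/-- The signed crossings of an Artin generator. -/
def artinCrossing (n : ℕ) (i : Fin (n - 1)) : CrossingGroup (Fin n) :=
  crossing 1 ⟨i, by omega⟩ ⟨i + 1, by omega⟩

theorem artinCrossing_rels (n : ℕ) : ∀ w ∈ braidRels n, FreeGroup.lift (artinCrossing n) w = 1 := by
  rintro w (⟨i, j, hij, rfl⟩ | ⟨i, j, hij, rfl⟩) <;>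
    simp only [map_mul, map_inv, FreeGroup.lift_apply_of, mul_inv_eq_one, artinCrossing]
  · apply (crossing_comm ..).eq <;> simp only [ne_eq, Fin.ext_iff] <;> omega
  · simp only [hij]
    refine (crossing_braid ?_ ?_ ?_ 1).symm <;> simp only [ne_eq, Fin.ext_iff] <;> omega

/-- The signed crossings of a braid. -/
def braidCrossings (n : ℕ) : BraidGroup n →* CrossingGroup (Fin n) :=
  PresentedGroup.toGroup (artinCrossing_rels n)

theorem braidCrossings_perm (g : BraidGroup n) : (braidCrossings n g).perm = braidPerm n g := by
  suffices h : (permHom (Fin n)).comp (braidCrossings n) = braidPerm n from DFunLike.congr_fun h g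
  refine PresentedGroup.ext fun i => ?_
  simp [braidCrossings, braidPerm, artinCrossing, braidSwap]

/-- The signed crossings of a class in `B_n / [P_n, P_n]`; they are well defined because pure
braids have commuting images. -/
def crossings (n : ℕ) : BraidQuot n →* CrossingGroup (Fin n) :=
  QuotientGroup.lift _ (braidCrossings n) <| by
    rw [Subgroup.commutator_le]
    intro g hg h hh
    rw [MonoidHom.mem_ker, map_commutatorElement, commutatorElement_eq_one_iff_commute]
    exact commute_of_perm_eq_one ((braidCrossings_perm g).trans hg)
      ((braidCrossings_perm h).trans hh)

theorem commute_of_crossings_perm_eq_one {g h : BraidQuot n} (hg : (crossings n g).perm = 1)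
    (hh : (crossings n h).perm = 1) : Commute g h := by
  induction g using QuotientGroup.induction_on with | H g => ?_
  induction h using QuotientGroup.induction_on with | H h => ?_
  rw [← commutatorElement_eq_one_iff_commute]
  exact (QuotientGroup.eq_one_iff _).2 <| Subgroup.commutator_mem_commutator
    ((braidCrossings_perm g).symm.trans hg) ((braidCrossings_perm h).symm.trans hh)

end Crossings

section ArtinGenerators

variable {n : ℕ}

theorem sigmaQ_succ (i : Fin (n - 1)) :
    sigmaQ n (i + 1) = QuotientGroup.mk (PresentedGroup.of i) := by
  have : 1 ≤ (i : ℕ) + 1 ∧ (i : ℕ) + 1 ≤ n - 1 := ⟨by omega, by omega⟩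
  simp [sigmaQ, this]

theorem sigmaQ_of_not_mem {i : ℕ} (h : ¬(1 ≤ i ∧ i ≤ n - 1)) : sigmaQ n i = 1 := dif_neg h

theorem crossings_sigmaQ {x y : Fin n} (h : (y : ℕ) = x + 1) :
    crossings n (sigmaQ n y) = crossing 1 x y := by
  obtain ⟨x, hx⟩ := x
  obtain ⟨y, hy⟩ := y
  obtain rfl : y = x + 1 := h
  have hσ := sigmaQ_succ (n := n) ⟨x, by omega⟩
  simp [hσ, crossings, braidCrossings, artinCrossing]

theorem sigmaQ_commute {i j : ℕ} (h : i + 2 ≤ j) : Commute (sigmaQ n i) (sigmaQ n j) := by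
  by_cases hi : 1 ≤ i ∧ i ≤ n - 1
  · by_cases hj : 1 ≤ j ∧ j ≤ n - 1
    · obtain ⟨i, rfl⟩ : ∃ k : Fin (n - 1), i = k + 1 :=
        ⟨⟨i - 1, by omega⟩, (Nat.sub_add_cancel hi.1).symm⟩
      obtain ⟨j, rfl⟩ : ∃ k : Fin (n - 1), j = k + 1 :=
        ⟨⟨j - 1, by omega⟩, (Nat.sub_add_cancel hj.1).symm⟩
      rw [sigmaQ_succ, sigmaQ_succ]
      refine congrArg QuotientGroup.mk (mul_inv_eq_one.1 ?_)
      exact PresentedGroup.one_of_mem (Or.inl ⟨i, j, by omega, rfl⟩)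
    · simp [sigmaQ_of_not_mem hj]
  · simp [sigmaQ_of_not_mem hi]

theorem sigmaQ_braid {i : ℕ} (hi : 1 ≤ i) (hn : i + 1 ≤ n - 1) :
    sigmaQ n (i + 1) * sigmaQ n i * sigmaQ n (i + 1) =
      sigmaQ n i * sigmaQ n (i + 1) * sigmaQ n i := by
  obtain ⟨k, rfl⟩ : ∃ k, i = k + 1 := ⟨i - 1, by omega⟩
  rw [sigmaQ_succ ⟨k + 1, by omega⟩, sigmaQ_succ ⟨k, by omega⟩]
  refine congrArg QuotientGroup.mk (mul_inv_eq_one.1 ?_)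
  exact PresentedGroup.one_of_mem (Or.inr ⟨⟨k, by omega⟩, ⟨k + 1, by omega⟩, rfl, rfl⟩)

theorem closure_sigmaQ (n : ℕ) : Subgroup.closure (sigmaQ n '' Set.Icc 1 (n - 1)) = ⊤ := by
  rw [eq_top_iff, ← Subgroup.map_top_of_surjective _
    (QuotientGroup.mk'_surjective ⁅pureBraid n, pureBraid n⁆),
    ← PresentedGroup.closure_range_of (braidRels n), MonoidHom.map_closure]
  apply Subgroup.closure_mono
  rintro _ ⟨_, ⟨i, rfl⟩, rfl⟩
  exact ⟨i + 1, by grind, sigmaQ_succ i⟩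

end ArtinGenerators

section PureGenerators

variable {n : ℕ}

theorem pureA_self_succ (n i : ℕ) : pureA n i (i + 1) = sigmaQ n i ^ 2 := by
  simp [pureA]

theorem pureA_succ {i j : ℕ} (h : i < j) :
    pureA n i (j + 1) = MulAut.conj (sigmaQ n j) (pureA n i j) := by
  obtain ⟨d, rfl⟩ := Nat.exists_eq_add_of_le' h
  have hidx : ∀ s, d + (i + 1) + 1 - 1 - (s + 1) = d + (i + 1) - 1 - s := by omega
  simp only [pureA, Nat.succ_eq_add_one, show d + (i + 1) + 1 - i - 1 = d + 1 by omega,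
    show d + (i + 1) - i - 1 = d by omega, List.range_succ_eq_map, List.map_cons, List.map_map,
    List.prod_cons, Function.comp_def, hidx, MulAut.conj_apply]
  simp [mul_assoc]

theorem crossings_pureA {x y : Fin n} (h : x < y) :
    crossings n (pureA n (x + 1) (y + 1)) = ⟨1, Pi.single s(x, y) 2⟩ := by
  obtain ⟨y, hy⟩ := y
  replace h : (x : ℕ) + 1 ≤ y := h
  induction y, h using Nat.le_induction with
  | base =>
    rw [pureA_self_succ, map_pow, crossings_sigmaQ (x := x) (y := ⟨x + 1, hy⟩) rfl]
    ext e
    · simp [pow_two]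
    · simp only [pow_two, mul_cr, crossing_perm, crossing_cr, single_map_perm, Equiv.swap_inv,
        Sym2.map_mk, Equiv.swap_apply_left, Equiv.swap_apply_right, Sym2.eq_swap (b := x)]
      rw [← Pi.add_apply, ← Pi.single_add, one_add_one_eq_two]
  | succ y hxy ih =>
    rw [pureA_succ (by simpa using hxy), MulAut.conj_apply, map_mul, map_mul, map_inv,
      ih (by omega), crossings_sigmaQ (x := ⟨y, by omega⟩) (y := ⟨y + 1, hy⟩) rfl]
    ext e
    · rw [conj_perm rfl]
    · rw [conj_cr rfl]
      simp only [single_map_perm, crossing_perm, inv_inv, Sym2.map_mk, Equiv.swap_apply_left]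
      rw [Equiv.swap_apply_of_ne_of_ne] <;> simp only [ne_eq, Fin.ext_iff] <;> omega

theorem crossings_pureA_perm {i j : ℕ} (hi : 1 ≤ i) (hij : i < j) (hj : j ≤ n) :
    (crossings n (pureA n i j)).perm = 1 := by
  obtain ⟨i, rfl⟩ := Nat.exists_eq_add_of_le' hi
  obtain ⟨j, rfl⟩ := Nat.exists_eq_add_of_le' (show 1 ≤ j by omega)
  rw [crossings_pureA (x := ⟨i, by omega⟩) (y := ⟨j, by omega⟩) (by simpa using hij)]

theorem conj_sigmaQ_perm {g : BraidQuot n} (hg : (crossings n g).perm = 1) (k : ℕ) :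
    (crossings n (MulAut.conj (sigmaQ n k) g)).perm = 1 := by
  rw [MulAut.conj_apply, map_mul, map_mul, map_inv, conj_perm hg]

theorem conj_sigmaQ_conj {g : BraidQuot n} (hg : (crossings n g).perm = 1) (k : ℕ) :
    MulAut.conj (sigmaQ n k) (MulAut.conj (sigmaQ n k) g) = g := by
  by_cases hk : 1 ≤ k ∧ k ≤ n - 1
  · have h := commute_of_crossings_perm_eq_one
      (crossings_pureA_perm (n := n) hk.1 k.lt_succ_self (by omega)) hg
    rw [pureA_self_succ] at h
    rw [← MulAut.mul_apply, ← map_mul, ← pow_two, MulAut.conj_apply, h.eq, mul_inv_cancel_right]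
  · simp [sigmaQ_of_not_mem hk]

theorem commute_sigmaQ_pureA_of_far {i j k : ℕ} (hij : i < j) (hk : j < k ∨ k + 2 ≤ i) :
    Commute (sigmaQ n k) (pureA n i j) := by
  have hfar : ∀ {l}, i ≤ l → l < j → Commute (sigmaQ n k) (sigmaQ n l) := fun {l} hil hlj =>
    hk.elim (fun h => (sigmaQ_commute (by omega)).symm) fun h => sigmaQ_commute (by omega)
  induction j, hij using Nat.le_induction with
  | base => rw [pureA_self_succ]; exact (hfar le_rfl i.lt_succ_self).pow_right 2
  | succ j hij ih =>
    have hj := hfar (Nat.le_of_succ_le hij) j.lt_succ_self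
    rw [pureA_succ hij]
    exact (hj.mul_right (ih (by omega) fun hil hlj => hfar hil (by omega))).mul_right hj.inv_right

theorem conj_sigmaQ_mul_sigmaQ {k : ℕ} (hk : 1 ≤ k) (hkn : k + 1 ≤ n - 1) :
    MulAut.conj (sigmaQ n (k + 1) * sigmaQ n k) (sigmaQ n (k + 1)) = sigmaQ n k := by
  rw [MulAut.conj_apply, sigmaQ_braid hk hkn]
  group

theorem conj_sigmaQ_pureA_succ {j k : ℕ} (hk : 1 ≤ k) (hkj : k + 1 < j) (hj : j ≤ n) :
    MulAut.conj (sigmaQ n k) (pureA n (k + 1) j) = pureA n k j := by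
  induction j, hkj using Nat.le_induction with
  | base =>
    have hp := crossings_pureA_perm (n := n) (i := k + 1) (by omega) (k + 1).lt_succ_self hj
    have hsq : pureA n k (k + 1) =
        MulAut.conj (sigmaQ n (k + 1)) (MulAut.conj (sigmaQ n k) (pureA n (k + 1) (k + 2))) := by
      rw [pureA_self_succ, pureA_self_succ, ← MulAut.mul_apply, ← map_mul, map_pow,
        conj_sigmaQ_mul_sigmaQ hk (by omega)]
    rw [Nat.succ_eq_add_one, pureA_succ k.lt_succ_self, hsq,
      conj_sigmaQ_conj (conj_sigmaQ_perm hp k)]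
  | succ j hij ih =>
    have hc : Commute (sigmaQ n k) (sigmaQ n j) := sigmaQ_commute hij
    rw [pureA_succ (by omega), pureA_succ (by omega), ← ih (by omega), ← MulAut.mul_apply,
      ← MulAut.mul_apply, ← map_mul, ← map_mul, hc.eq]

theorem commute_sigmaQ_pureA_of_between {i j k : ℕ} (hik : i < k) (hkj : k + 1 < j)
    (hj : j ≤ n) : Commute (sigmaQ n k) (pureA n i j) := by
  induction j, hkj using Nat.le_induction with
  | base =>
    have h := (commute_sigmaQ_pureA_of_far (n := n) hik (Or.inl k.lt_succ_self)).map
      (MulAut.conj (sigmaQ n (k + 1) * sigmaQ n k))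
    rwa [conj_sigmaQ_mul_sigmaQ (by omega) (by omega), map_mul, MulAut.mul_apply,
      ← pureA_succ hik, ← pureA_succ (by omega)] at h
  | succ j hij ih =>
    have hc : Commute (sigmaQ n k) (sigmaQ n j) := sigmaQ_commute hij
    rw [pureA_succ (by omega)]
    exact (hc.mul_right (ih (by omega))).mul_right hc.inv_right

end PureGenerators

section DescProd

variable {M N : Type*} [Monoid M] [Monoid N]

/-- The product `f b * f (b - 1) * ⋯ * f (b - k + 1)` with descending indices, the shape of the
words in `pureA` and `deltaBlock`. -/
def descProd (f : ℕ → M) (b k : ℕ) : M := ((List.range k).map fun s => f (b - s)).prod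

@[simp] theorem descProd_zero (f : ℕ → M) (b : ℕ) : descProd f b 0 = 1 := rfl

theorem descProd_succ (f : ℕ → M) (b k : ℕ) :
    descProd f b (k + 1) = descProd f b k * f (b - k) := by
  simp [descProd, List.range_succ]

theorem map_descProd (φ : M →* N) (f : ℕ → M) (b k : ℕ) :
    φ (descProd f b k) = descProd (fun i => φ (f i)) b k := by
  simp [descProd, map_list_prod, Function.comp_def]

end DescProd

/-! ### The Coxeter relations of the symmetric group -/

section Coxeter

variable {G : Type*} [Group G] {s : ℕ → G} {k n : ℕ} {ρ : G →* Equiv.Perm (Fin n)}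

theorem map_descProd_apply
    (hρ : ∀ x y : Fin n, (y : ℕ) = x + 1 → ρ (s y) = Equiv.swap x y) {x y : Fin n} {d : ℕ}
    (h : (x : ℕ) + d = y) : ρ (descProd s y d) x = y := by
  induction d generalizing x with
  | zero => simpa [Fin.ext_iff] using h
  | succ d ih =>
    have hx : (x : ℕ) + 1 < n := by omega
    have hyd : (y : ℕ) - d = x + 1 := by omega
    rw [descProd_succ, map_mul, Equiv.Perm.mul_apply, hyd, hρ x ⟨x + 1, hx⟩ rfl,
      Equiv.swap_apply_left]
    exact ih (by simp only; omega)

theorem map_closure_apply_of_lt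
    (hρ : ∀ x y : Fin n, (y : ℕ) = x + 1 → ρ (s y) = Equiv.swap x y) {z : Fin n} (hz : k < z)
    {h : G} (hh : h ∈ Subgroup.closure (s '' Set.Icc 1 k)) : ρ h z = z := by
  have : Subgroup.closure (s '' Set.Icc 1 k) ≤
      (MulAction.stabilizer (Equiv.Perm (Fin n)) z).comap ρ := by
    rw [Subgroup.closure_le]
    rintro _ ⟨i, ⟨hi, hik⟩, rfl⟩
    have hρi := hρ ⟨i - 1, by omega⟩ ⟨i, by omega⟩ (by simp only; omega)
    simp only at hρi
    simp only [Subgroup.coe_comap, Set.mem_preimage, SetLike.mem_coe,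
      MulAction.mem_stabilizer_iff, Equiv.Perm.smul_def, hρi]
    apply Equiv.swap_apply_of_ne_of_ne <;> simp only [ne_eq, Fin.ext_iff] <;> omega
  exact this hh

/-- The elements `s 1, …, s k` satisfy the relations of the Coxeter presentation of the symmetric
group on `k + 1` letters; the relations without a bound are imposed on the whole sequence `s`. -/
structure IsCoxeterSeq (s : ℕ → G) (k : ℕ) : Prop where
  mul_self (i : ℕ) : s i * s i = 1
  commute {i j : ℕ} : i + 2 ≤ j → Commute (s i) (s j)
  braid {i : ℕ} : 1 ≤ i → i + 1 ≤ k → s (i + 1) * s i * s (i + 1) = s i * s (i + 1) * s i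

namespace IsCoxeterSeq

theorem mono {l : ℕ} (hs : IsCoxeterSeq s l) (hkl : k ≤ l) : IsCoxeterSeq s k :=
  ⟨hs.mul_self, hs.commute, fun hi hik => hs.braid hi (hik.trans hkl)⟩

theorem commute_descProd (hs : IsCoxeterSeq s k) {b d i : ℕ} (h : i + d + 1 ≤ b) :
    Commute (s i) (descProd s b d) := by
  induction d with
  | zero => simp
  | succ d ih =>
    rw [descProd_succ]
    exact (ih (by omega)).mul_right (hs.commute (by omega))

theorem descProd_mul (hs : IsCoxeterSeq s k) {d i : ℕ} (hd : d ≤ k) (hik : i + 1 ≤ k)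
    (hid : k + 1 ≤ i + d) : descProd s k d * s (i + 1) = s i * descProd s k d := by
  induction d with
  | zero => omega
  | succ d ih =>
    rw [descProd_succ]
    rcases hid.eq_or_lt with h | h
    · obtain ⟨e, rfl⟩ : ∃ e, d = e + 1 := ⟨d - 1, by omega⟩
      rw [descProd_succ, show k - (e + 1) = i by omega, show k - e = i + 1 by omega]
      have hc : s i * descProd s k e = descProd s k e * s i := hs.commute_descProd (by omega)
      calc descProd s k e * s (i + 1) * s i * s (i + 1)
          = descProd s k e * (s (i + 1) * s i * s (i + 1)) := by simp only [mul_assoc]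
        _ = descProd s k e * s i * (s (i + 1) * s i) := by
          rw [hs.braid (by omega) hik]; simp only [mul_assoc]
        _ = s i * (descProd s k e * s (i + 1) * s i) := by rw [← hc]; simp only [mul_assoc]
    · rw [mul_assoc, (hs.commute (by omega)).eq, ← mul_assoc, ih (by omega) (by omega), mul_assoc]

-- The products `descProd s (k + 1) d`, `d ≤ k + 1`, represent the right cosets of the subgroup
-- generated by `s 1, …, s k`.
theorem exists_descProd_mul_eq (hs : IsCoxeterSeq s (k + 1)) {d i : ℕ} (hd : d ≤ k + 1)
    (hi : 1 ≤ i) (hik : i ≤ k + 1) :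
    ∃ h ∈ Subgroup.closure (s '' Set.Icc 1 k), ∃ d' ≤ k + 1,
      descProd s (k + 1) d * s i = h * descProd s (k + 1) d' := by
  have hmem : ∀ {l}, 1 ≤ l → l ≤ k → s l ∈ Subgroup.closure (s '' Set.Icc 1 k) :=
    fun h h' => Subgroup.subset_closure ⟨_, ⟨h, h'⟩, rfl⟩
  obtain h | h | h | h : i + d ≤ k ∨ i + d = k + 1 ∨ i + d = k + 2 ∨ k + 3 ≤ i + d := by omega
  · exact ⟨s i, hmem hi (by omega), d, hd, (hs.commute_descProd (by omega)).symm.eq⟩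
  · refine ⟨1, one_mem _, d + 1, by omega, ?_⟩
    rw [descProd_succ, one_mul, show k + 1 - d = i by omega]
  · obtain ⟨d, rfl⟩ : ∃ e, d = e + 1 := ⟨d - 1, by omega⟩
    refine ⟨1, one_mem _, d, by omega, ?_⟩
    rw [descProd_succ, show k + 1 - d = i by omega, mul_assoc, hs.mul_self, mul_one, one_mul]
  · obtain ⟨i, rfl⟩ : ∃ l, i = l + 1 := ⟨i - 1, by omega⟩
    exact ⟨s i, hmem (by omega) (by omega), d, hd, hs.descProd_mul hd hik (by omega)⟩

theorem exists_eq_mul_descProd (hs : IsCoxeterSeq s (k + 1)) {g : G}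
    (hg : g ∈ Subgroup.closure (s '' Set.Icc 1 (k + 1))) :
    ∃ h ∈ Subgroup.closure (s '' Set.Icc 1 k), ∃ d ≤ k + 1, g = h * descProd s (k + 1) d := by
  have step : ∀ g i, 1 ≤ i → i ≤ k + 1 →
      (∃ h ∈ Subgroup.closure (s '' Set.Icc 1 k), ∃ d ≤ k + 1, g = h * descProd s (k + 1) d) →
      ∃ h ∈ Subgroup.closure (s '' Set.Icc 1 k), ∃ d ≤ k + 1,
        g * s i = h * descProd s (k + 1) d := by
    rintro _ i hi hik ⟨h, hh, d, hd, rfl⟩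
    obtain ⟨h', hh', d', hd', heq⟩ := hs.exists_descProd_mul_eq hd hi hik
    exact ⟨h * h', mul_mem hh hh', d', hd', by rw [mul_assoc, heq, mul_assoc]⟩
  induction hg using Subgroup.closure_induction_right with
  | one => exact ⟨1, one_mem _, 0, by omega, by simp⟩
  | mul_right x _ y hy ih =>
    obtain ⟨i, hi, rfl⟩ := hy
    exact step x i hi.1 hi.2 ih
  | mul_inv_cancel x _ y hy ih =>
    obtain ⟨i, hi, rfl⟩ := hy
    rw [inv_eq_of_mul_eq_one_left (hs.mul_self i)]
    exact step x i hi.1 hi.2 ih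

theorem eq_one_of_map_eq_one (hs : IsCoxeterSeq s k) (hk : k ≤ n - 1)
    (hρ : ∀ x y : Fin n, (y : ℕ) = x + 1 → ρ (s y) = Equiv.swap x y) {g : G}
    (hg : g ∈ Subgroup.closure (s '' Set.Icc 1 k)) (h1 : ρ g = 1) : g = 1 := by
  induction k generalizing g with
  | zero => simpa using hg
  | succ k ih =>
    obtain ⟨h, hh, d, hd, rfl⟩ := hs.exists_eq_mul_descProd hg
    let x : Fin n := ⟨k + 1 - d, by omega⟩
    let y : Fin n := ⟨k + 1, by omega⟩
    have hxy : ρ (h * descProd s (k + 1) d) x = y := by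
      have hd' : (x : ℕ) + d = y := by simp only [x, y]; omega
      rw [map_mul, Equiv.Perm.mul_apply, show k + 1 = (y : ℕ) from rfl, map_descProd_apply hρ hd',
        map_closure_apply_of_lt hρ k.lt_succ_self hh]
    obtain rfl : d = 0 := by
      rw [h1, Equiv.Perm.one_apply, Fin.ext_iff] at hxy
      simp only [x, y] at hxy
      omega
    rw [descProd_zero, mul_one] at h1 ⊢
    exact ih (hs.mono k.le_succ) (by omega) hh h1

end IsCoxeterSeq

end Coxeter

/-! ### Generators of `P_n / [P_n, P_n]` -/

section PureClosure

variable {n : ℕ}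

/-- The pairs of strings `1 ≤ r < s ≤ n`, counted from `0`. -/
abbrev StringPair (n : ℕ) : Type := {p : Fin n × Fin n // p.1 < p.2}

/-- The subgroup of `B_n / [P_n, P_n]` generated by the `A_{r,s}`. -/
def pureClosure (n : ℕ) : Subgroup (BraidQuot n) :=
  Subgroup.closure (Set.range fun p : StringPair n => pureA n (p.1.1 + 1) (p.1.2 + 1))

theorem pureA_mem {i j : ℕ} (hi : 1 ≤ i) (hij : i < j) (hj : j ≤ n) :
    pureA n i j ∈ pureClosure n := by
  obtain ⟨i, rfl⟩ := Nat.exists_eq_add_of_le' hi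
  obtain ⟨j, rfl⟩ := Nat.exists_eq_add_of_le' (show 1 ≤ j by omega)
  exact Subgroup.subset_closure ⟨⟨(⟨i, by omega⟩, ⟨j, by omega⟩), by simpa using hij⟩, rfl⟩

theorem conj_sigmaQ_pureA_mem {i j k : ℕ} (hi : 1 ≤ i) (hij : i < j) (hj : j ≤ n)
    (hk : 1 ≤ k) (hkn : k ≤ n - 1) : MulAut.conj (sigmaQ n k) (pureA n i j) ∈ pureClosure n := by
  have of_commute (h : Commute (sigmaQ n k) (pureA n i j)) :
      MulAut.conj (sigmaQ n k) (pureA n i j) ∈ pureClosure n := by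
    rw [MulAut.conj_apply, h.eq, mul_inv_cancel_right]
    exact pureA_mem hi hij hj
  obtain h | rfl | ⟨rfl, h⟩ | ⟨rfl, rfl⟩ | rfl | ⟨rfl, h⟩ | ⟨h, h'⟩ :
    (j < k ∨ k + 2 ≤ i) ∨ j = k ∨ (j = k + 1 ∧ i < k) ∨ (j = k + 1 ∧ i = k) ∨ i = k + 1 ∨
      (i = k ∧ k + 1 < j) ∨ (i < k ∧ k + 1 < j) := by omega
  · exact of_commute (commute_sigmaQ_pureA_of_far hij h)
  · rw [← pureA_succ hij]
    exact pureA_mem hi (by omega) (by omega)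
  · rw [pureA_succ h, conj_sigmaQ_conj (crossings_pureA_perm hi h (by omega))]
    exact pureA_mem hi h (by omega)
  · exact of_commute (by rw [pureA_self_succ]; exact (Commute.refl _).pow_right 2)
  · rw [conj_sigmaQ_pureA_succ hk hij hj]
    exact pureA_mem hk (by omega) hj
  · rw [← conj_sigmaQ_pureA_succ hk h hj,
      conj_sigmaQ_conj (crossings_pureA_perm (by omega) h (by omega))]
    exact pureA_mem (by omega) h hj
  · exact of_commute (commute_sigmaQ_pureA_of_between h h' hj)

theorem crossings_perm_of_mem_pureClosure {g : BraidQuot n} (hg : g ∈ pureClosure n) :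
    (crossings n g).perm = 1 := by
  have : pureClosure n ≤ ((permHom (Fin n)).comp (crossings n)).ker := by
    rw [pureClosure, Subgroup.closure_le]
    rintro _ ⟨p, rfl⟩
    exact congrArg perm (crossings_pureA p.2)
  exact this hg

theorem conj_sigmaQ_mem {k : ℕ} (hk : 1 ≤ k) (hkn : k ≤ n - 1) {g : BraidQuot n}
    (hg : g ∈ pureClosure n) : MulAut.conj (sigmaQ n k) g ∈ pureClosure n := by
  suffices h : pureClosure n ≤ (pureClosure n).comap (MulAut.conj (sigmaQ n k)).toMonoidHom from
    h hg
  refine (Subgroup.closure_le _).2 ?_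
  rintro _ ⟨p, rfl⟩
  exact conj_sigmaQ_pureA_mem p.1.1.val.succ_pos (Nat.succ_lt_succ p.2) p.1.2.isLt hk hkn

instance pureClosure_normal (n : ℕ) : (pureClosure n).Normal := by
  rw [← Subgroup.normalizer_eq_top_iff, eq_top_iff, ← closure_sigmaQ, Subgroup.closure_le]
  rintro _ ⟨k, ⟨hk, hkn⟩, rfl⟩
  rw [SetLike.mem_coe, Subgroup.mem_normalizer_iff]
  refine fun g => ⟨fun hg => conj_sigmaQ_mem hk hkn hg, fun hg => ?_⟩
  have hp : (crossings n g).perm = 1 := by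
    simpa using crossings_perm_of_mem_pureClosure hg
  rw [← conj_sigmaQ_conj hp k]
  exact conj_sigmaQ_mem hk hkn hg

theorem mem_pureClosure_iff {g : BraidQuot n} :
    g ∈ pureClosure n ↔ (crossings n g).perm = 1 := by
  refine ⟨crossings_perm_of_mem_pureClosure, fun hg => ?_⟩
  rw [← QuotientGroup.eq_one_iff]
  let s (i : ℕ) : BraidQuot n ⧸ pureClosure n := QuotientGroup.mk (sigmaQ n i)
  let ρ : BraidQuot n ⧸ pureClosure n →* Equiv.Perm (Fin n) :=
    QuotientGroup.lift _ ((permHom (Fin n)).comp (crossings n)) fun _ hx =>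
      crossings_perm_of_mem_pureClosure hx
  have hs : IsCoxeterSeq s (n - 1) :=
    { mul_self := fun i => by
        rw [← QuotientGroup.mk_mul, QuotientGroup.eq_one_iff, ← pow_two]
        by_cases hi : 1 ≤ i ∧ i ≤ n - 1
        · rw [← pureA_self_succ]
          exact pureA_mem hi.1 i.lt_succ_self (by omega)
        · simp [sigmaQ_of_not_mem hi]
      commute := fun hij => (sigmaQ_commute hij).map (QuotientGroup.mk' (pureClosure n))
      braid := fun hi hin => congrArg (QuotientGroup.mk' (pureClosure n)) (sigmaQ_braid hi hin) }
  have hgen : (g : BraidQuot n ⧸ pureClosure n) ∈ Subgroup.closure (s '' Set.Icc 1 (n - 1)) := by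
    have := Subgroup.mem_map_of_mem (QuotientGroup.mk' (pureClosure n))
      ((closure_sigmaQ n).symm ▸ Subgroup.mem_top g)
    rwa [MonoidHom.map_closure, Set.image_image] at this
  exact hs.eq_one_of_map_eq_one (ρ := ρ) le_rfl
    (fun x y hxy => congrArg perm (crossings_sigmaQ hxy)) hgen hg

instance pureClosure_isMulCommutative (n : ℕ) : IsMulCommutative (pureClosure n) :=
  ⟨⟨fun g h => Subtype.ext (commute_of_crossings_perm_eq_one
    (crossings_perm_of_mem_pureClosure g.2) (crossings_perm_of_mem_pureClosure h.2))⟩⟩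

/-- The number of crossings of a pair of strands, on pure braids. -/
def crossingNumber (e : Sym2 (Fin n)) : pureClosure n →* Multiplicative ℤ where
  toFun g := Multiplicative.ofAdd ((crossings n g).cr e)
  map_one' := by simp
  map_mul' g h := by simp [crossings_perm_of_mem_pureClosure h.2, ofAdd_add]

theorem crossings_pureA_cr (p p' : StringPair n) :
    (crossings n (pureA n (p.1.1 + 1) (p.1.2 + 1))).cr s(p'.1.1, p'.1.2) =
      if p = p' then 2 else 0 := by
  have : s(p'.1.1, p'.1.2) = s(p.1.1, p.1.2) ↔ p = p' := by
    obtain ⟨⟨x, y⟩, h⟩ := p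
    obtain ⟨⟨x', y'⟩, h'⟩ := p'
    simp only [Sym2.eq_iff, Subtype.mk.injEq, Prod.mk.injEq] at h h' ⊢
    omega
  simp only [crossings_pureA p.2, Pi.single_apply, this]

theorem exists_crossings_eq {g : BraidQuot n} (hg : (crossings n g).perm = 1) :
    ∃ k : StringPair n → ℤ,
      (∀ p, (crossings n g).cr s(p.1.1, p.1.2) = 2 * k p) ∧ ((∀ p, k p = 0) → g = 1) := by
  let A (p : StringPair n) : pureClosure n :=
    ⟨pureA n (p.1.1 + 1) (p.1.2 + 1), Subgroup.subset_closure ⟨p, rfl⟩⟩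
  have hA : Subgroup.closure (Set.range A) = ⊤ := by
    refine .trans (congrArg Subgroup.closure ?_) Subgroup.closure_closure_coe_preimage
    ext x
    simp only [A, Set.mem_range, Subtype.ext_iff]
    rfl
  obtain ⟨k, hk⟩ := Subgroup.exists_of_mem_closure_range A ⟨g, mem_pureClosure_iff.2 hg⟩
    (hA ▸ Subgroup.mem_top _)
  refine ⟨k, fun p => ?_, fun h => ?_⟩
  · have hA_apply (p') : crossingNumber s(p.1.1, p.1.2) (A p') =
        Multiplicative.ofAdd (if p' = p then 2 else 0) :=
      congrArg Multiplicative.ofAdd (crossings_pureA_cr p' p)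
    have := congrArg (crossingNumber s(p.1.1, p.1.2)) hk
    simp only [map_prod, map_zpow, hA_apply, ← ofAdd_zsmul, ← ofAdd_sum] at this
    refine (congrArg Multiplicative.toAdd this).trans ?_
    simp [mul_comm]
  · simpa [h] using hk

theorem two_dvd_crossings {g : BraidQuot n} (hg : (crossings n g).perm = 1) {x y : Fin n}
    (hxy : x ≠ y) : 2 ∣ (crossings n g).cr s(x, y) := by
  obtain ⟨k, hk, -⟩ := exists_crossings_eq hg
  rcases hxy.lt_or_gt with h | h
  · exact ⟨_, hk ⟨(x, y), h⟩⟩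
  · exact ⟨_, Sym2.eq_swap ▸ hk ⟨(y, x), h⟩⟩

theorem eq_one_of_crossings {g : BraidQuot n} (hg : (crossings n g).perm = 1)
    (h : ∀ x y, x ≠ y → (crossings n g).cr s(x, y) = 0) : g = 1 := by
  obtain ⟨k, hk, hk'⟩ := exists_crossings_eq hg
  refine hk' fun p => ?_
  have := hk p
  rw [h _ _ p.2.ne] at this
  omega

end PureClosure

/-! ### Crossing numbers of `δ` -/

section Delta

variable {n : ℕ} {ε : ℤ} {f : ℕ → CrossingGroup (Fin n)}

theorem descProd_crossing_perm (hf : ∀ x y : Fin n, (y : ℕ) = x + 1 → f y = crossing ε x y)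
    {x y : Fin n} {d : ℕ} (h : (x : ℕ) + d = y) (z : Fin n) :
    ((descProd f y d).perm z : ℕ) =
      if z = x then (y : ℕ) else if x < z ∧ z ≤ y then z - 1 else z := by
  induction d generalizing x z with
  | zero => simp only [descProd_zero, one_perm, Equiv.Perm.one_apply]; grind
  | succ d ih =>
    have hx : (x : ℕ) + 1 < n := by omega
    rw [descProd_succ, show (y : ℕ) - d = x + 1 by omega, hf x ⟨x + 1, hx⟩ rfl, mul_perm,
      Equiv.Perm.mul_apply, ih (x := ⟨x + 1, hx⟩) (by simp only; omega)]
    simp only [crossing_perm, Equiv.swap_apply_def, Fin.ext_iff, Fin.lt_def, Fin.le_def]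
    grind

theorem descProd_crossing_cr (hf : ∀ x y : Fin n, (y : ℕ) = x + 1 → f y = crossing ε x y)
    {x y : Fin n} {d : ℕ} (h : (x : ℕ) + d = y) (z w : Fin n) :
    (descProd f y d).cr s(z, w) =
      if (z = x ∧ x < w ∧ w ≤ y) ∨ (w = x ∧ x < z ∧ z ≤ y) then ε else 0 := by
  induction d generalizing x z w with
  | zero => simp only [descProd_zero, one_cr]; grind
  | succ d ih =>
    have hx : (x : ℕ) + 1 < n := by omega
    rw [descProd_succ, show (y : ℕ) - d = x + 1 by omega, hf x ⟨x + 1, hx⟩ rfl, mul_cr,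
      Sym2.map_mk, ih (x := ⟨x + 1, hx⟩) (by simp only; omega)]
    simp only [crossing_perm, crossing_cr, Equiv.swap_apply_def, Pi.single_apply, Sym2.eq_iff,
      Fin.ext_iff, Fin.lt_def, Fin.le_def]
    grind

theorem crossings_deltaBlock (n a c : ℕ) : crossings n (deltaBlock n a (2 * c + 1)) =
    descProd (fun i => crossings n (sigmaQ n i)) (a + 2 * c) c *
      descProd (fun i => (crossings n (sigmaQ n i))⁻¹) (a + c) c := by
  have h : deltaBlock n a (2 * c + 1) =
      descProd (sigmaQ n) (a + 2 * c) c * descProd (fun i => (sigmaQ n i)⁻¹) (a + c) c := by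
    rw [deltaBlock, show (2 * c + 1 - 1) / 2 = c by omega]
    rfl
  simp only [h, map_mul, map_descProd, map_inv]

theorem inv_crossings_sigmaQ {x y : Fin n} (h : (y : ℕ) = x + 1) :
    (crossings n (sigmaQ n y))⁻¹ = crossing (-1) x y := by
  rw [crossings_sigmaQ h, crossing_inv]

theorem crossings_deltaBlock_perm {x y : Fin n} {c : ℕ} (h : (x : ℕ) + 2 * c = y) (z : Fin n) :
    ((crossings n (deltaBlock n x (2 * c + 1))).perm z : ℕ) =
      if z = x then (y : ℕ) else if x < z ∧ z ≤ y then z - 1 else z := by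
  have hc : x + c < n := by omega
  have h₁ := descProd_crossing_perm (f := fun i => crossings n (sigmaQ n i)) (d := c)
    (x := ⟨x + c, hc⟩) (y := y) (fun _ _ => crossings_sigmaQ) (by simp only; omega)
  have h₂ := descProd_crossing_perm (f := fun i => (crossings n (sigmaQ n i))⁻¹) (d := c)
    (x := x) (y := ⟨x + c, hc⟩) (fun _ _ => inv_crossings_sigmaQ) rfl z
  rw [crossings_deltaBlock, mul_perm, Equiv.Perm.mul_apply, h, h₁]
  simp only [Fin.ext_iff, Fin.lt_def, Fin.le_def] at h₂ ⊢
  grind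

theorem crossings_deltaBlock_cr {x y : Fin n} {c : ℕ} (h : (x : ℕ) + 2 * c = y) {z w : Fin n}
    (hzw : z ≤ w) : (crossings n (deltaBlock n x (2 * c + 1))).cr s(z, w) =
      if z = x ∧ x < w ∧ w ≤ y then if (w : ℕ) ≤ x + c then -1 else 1 else 0 := by
  have hc : x + c < n := by omega
  have hperm := descProd_crossing_perm (f := fun i => (crossings n (sigmaQ n i))⁻¹) (d := c)
    (x := x) (y := ⟨x + c, hc⟩) (fun _ _ => inv_crossings_sigmaQ) rfl
  rw [crossings_deltaBlock, mul_cr, Sym2.map_mk, h,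
    descProd_crossing_cr (d := c) (x := ⟨x + c, hc⟩) (y := y)
      (fun _ _ => crossings_sigmaQ) (by simp only; omega),
    descProd_crossing_cr (d := c) (x := x) (y := ⟨x + c, hc⟩)
      (fun _ _ => inv_crossings_sigmaQ) rfl]
  have hz := hperm z
  have hw := hperm w
  simp only [Fin.ext_iff, Fin.lt_def, Fin.le_def] at hz hw hzw ⊢
  grind

end Delta

theorem zmod_val_sub_one {k : ℕ} [NeZero k] (u : ZMod k) :
    (u - 1).val = if u.val = 0 then k - 1 else u.val - 1 := by
  obtain _ | k := k
  · exact absurd rfl (NeZero.ne 0)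
  · refine (Fin.coe_sub_one u).trans ?_
    simp only [ZMod.val_eq_zero, Nat.add_sub_cancel]
    rfl

theorem zmod_val_neg_one {k : ℕ} [NeZero k] : (-1 : ZMod k).val = k - 1 := by
  rw [← zero_sub, zmod_val_sub_one, ZMod.val_zero, if_pos rfl]

theorem zmod_finEquiv_symm_val {k : ℕ} [NeZero k] (u : ZMod k) :
    ((ZMod.finEquiv k).symm u : ℕ) = u.val := by
  obtain _ | k := k
  · exact absurd rfl (NeZero.ne 0)
  · rfl

section Points

variable {t : ℕ} (m : Fin t → ℕ)

/-- The strings of the braids, labelled by their block and their position in it. Positions are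
counted from `0` and taken modulo the block size, so that `δ` acts by translation. -/
abbrev Point : Type := Σ j, ZMod (m j)

/-- The permutation translating the positions in the block `j` by `w j`. -/
def shift {m : Fin t → ℕ} (w : ∀ j, ZMod (m j)) : Equiv.Perm (Point m) :=
  Equiv.sigmaCongrRight fun j => Equiv.addRight (w j)

theorem blockStart_add_le {j l : Fin t} (h : j < l) : blockStart m j + m j ≤ blockStart m l := by
  rw [blockStart, add_comm, ← Finset.sum_insert (by simp)]
  refine Finset.sum_le_sum_of_subset fun i hi => ?_
  rw [Finset.Iio_insert, Finset.mem_Iic] at hi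
  exact Finset.mem_Iio.2 (hi.trans_lt h)

variable {m}

theorem shift_apply (w : ∀ j, ZMod (m j)) (P : Point m) : shift w P = ⟨P.1, P.2 + w P.1⟩ := rfl

theorem shift_zero : shift (0 : ∀ j, ZMod (m j)) = 1 := by
  ext P : 1
  simp [shift_apply]

theorem shift_add (w w' : ∀ j, ZMod (m j)) : shift (w + w') = shift w * shift w' := by
  ext P : 1
  simp [shift_apply, add_comm (w P.1), add_assoc]

theorem shift_neg (w : ∀ j, ZMod (m j)) : shift (-w) = (shift w)⁻¹ := by
  rw [eq_inv_iff_mul_eq_one, ← shift_add, neg_add_cancel, shift_zero]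

theorem shift_nsmul (w : ∀ j, ZMod (m j)) (k : ℕ) : shift (k • w) = shift w ^ k := by
  induction k with
  | zero => simp [shift_zero]
  | succ k ih => rw [succ_nsmul, shift_add, ih, pow_succ]

theorem list_map_shift_prod (l : List (∀ j, ZMod (m j))) : (l.map shift).prod = shift l.sum := by
  induction l with
  | nil => exact shift_zero.symm
  | cons w l ih => rw [List.map_cons, List.prod_cons, List.sum_cons, ih, shift_add]

variable [∀ j, NeZero (m j)]

variable (m) in
/-- The string with a given label, counted from `0`. -/
def strand : Point m ≃ Fin (numStrings m) :=
  (Equiv.sigmaCongrRight fun j => (ZMod.finEquiv (m j)).symm.toEquiv).trans finSigmaFinEquiv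

theorem strand_val (P : Point m) : (strand m P : ℕ) = blockStart m P.1 + P.2.val := by
  have h : (Finset.univ : Finset (Fin P.1)).map (Fin.castLEEmb P.1.2.le) = Finset.Iio P.1 := by
    ext i
    simp only [Finset.mem_map, Finset.mem_univ, true_and, Finset.mem_Iio]
    exact ⟨fun ⟨x, hx⟩ => hx ▸ x.2, fun hi => ⟨⟨i, hi⟩, rfl⟩⟩
  rw [blockStart, ← h, Finset.sum_map, ← zmod_finEquiv_symm_val]
  exact finSigmaFinEquiv_apply _

theorem strand_lt_strand {P Q : Point m} (h : P.1 < Q.1) : strand m P < strand m Q := by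
  have := blockStart_add_le m h
  have := P.2.val_lt
  rw [Fin.lt_def, strand_val, strand_val]
  omega

theorem deltaBlock_perm_strand {j : Fin t} (hj : Odd (m j)) (P : Point m) :
    (crossings _ (deltaBlock _ (blockStart m j) (m j))).perm (strand m P) =
      strand m (shift (-Pi.single j 1) P) := by
  obtain ⟨c, hc⟩ := hj
  have h := crossings_deltaBlock_perm (x := strand m ⟨j, 0⟩) (y := strand m ⟨j, -1⟩) (c := c)
    (by simp only [strand_val, ZMod.val_zero, zmod_val_neg_one]; omega) (strand m P)
  rw [strand_val, ZMod.val_zero, add_zero, ← hc] at h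
  rw [Fin.ext_iff, h, shift_apply]
  rcases lt_trichotomy P.1 j with hP | rfl | hP
  · have := strand_lt_strand (Q := ⟨j, 0⟩) hP
    simp [hP.ne, this.ne, this.not_gt]
  · have := P.2.val_lt
    have := zmod_val_sub_one P.2
    simp only [Fin.ext_iff, Fin.lt_def, Fin.le_def, strand_val, zmod_val_neg_one,
      Pi.neg_apply, Pi.single_eq_same, ← sub_eq_add_neg, ZMod.val_zero]
    grind
  · have h₁ := strand_lt_strand (P := ⟨j, 0⟩) hP
    have h₂ := strand_lt_strand (P := ⟨j, -1⟩) hP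
    simp [hP.ne', h₁.ne', h₂.not_ge]

theorem deltaBlock_cr_strand {j : Fin t} (hj : Odd (m j)) {P Q : Point m}
    (hPQ : strand m P ≤ strand m Q) :
    (crossings _ (deltaBlock _ (blockStart m j) (m j))).cr s(strand m P, strand m Q) =
      if P = ⟨j, 0⟩ ∧ Q.1 = j ∧ Q.2 ≠ 0 then if Q.2.val ≤ m j / 2 then -1 else 1 else 0 := by
  obtain ⟨c, hc⟩ := hj
  have h := crossings_deltaBlock_cr (x := strand m ⟨j, 0⟩) (y := strand m ⟨j, -1⟩) (c := c)
    (by simp only [strand_val, ZMod.val_zero, zmod_val_neg_one]; omega) hPQ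
  rw [strand_val, ZMod.val_zero, add_zero, ← hc] at h
  simp only [h, (strand m).injective.eq_iff]
  rcases lt_trichotomy Q.1 j with hQ | rfl | hQ
  · have := strand_lt_strand (Q := ⟨j, 0⟩) hQ
    simp [hQ.ne, this.not_gt]
  · have := Q.2.val_lt
    have := ZMod.val_eq_zero Q.2
    simp only [Fin.lt_def, Fin.le_def, strand_val, zmod_val_neg_one, ZMod.val_zero]
    grind
  · have := strand_lt_strand (P := ⟨j, -1⟩) hQ
    simp [hQ.ne', this.not_ge]

end Points

section BlockHom

variable {t : ℕ} (m : Fin t → ℕ)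

/-- Indicates the pairs of strings of one block whose positions differ by at most half the block
size. -/
def blockTwist : Sym2 (Point m) → ℤ :=
  Sym2.lift ⟨fun P Q => if P.1 = Q.1 ∧ P.2.val ≤ Q.2.val + m P.1 / 2 ∧
    Q.2.val ≤ P.2.val + m Q.1 / 2 then 1 else 0, fun P Q => by simp only [eq_comm, and_comm]⟩

variable [∀ j, NeZero (m j)]

/-- The crossing numbers of `B_n / [P_n, P_n]` in the labelling by blocks, corrected by the
coboundary of `blockTwist`. The correction makes the crossing numbers of `δ` vanish. -/
def blockHom : BraidQuot (numStrings m) →* CrossingGroup (Point m) :=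
  ((MulAut.conj ⟨1, -blockTwist m⟩).toMonoidHom.comp
    (CrossingGroup.congr (strand m).symm).toMonoidHom).comp (crossings (numStrings m))

variable {m}

theorem blockHom_perm (g : BraidQuot (numStrings m)) :
    (blockHom m g).perm = (strand m).symm.permCongr (crossings _ g).perm := by
  simp [blockHom]

theorem blockHom_cr (g : BraidQuot (numStrings m)) (e : Sym2 (Point m)) :
    (blockHom m g).cr e = (crossings _ g).cr (e.map (strand m)) + blockTwist m e -
      blockTwist m (e.map (blockHom m g).perm) := by
  simp only [blockHom, MonoidHom.comp_apply, MulEquiv.coe_toMonoidHom, MulAut.conj_apply, mul_cr,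
    mul_perm, inv_cr, inv_perm, congr_apply_cr, congr_apply_perm, inv_one, one_mul, mul_one,
    Equiv.symm_symm, Equiv.Perm.coe_one, Sym2.map_id, Pi.neg_apply, id_eq]
  ring

theorem blockHom_perm_eq_one_iff {g : BraidQuot (numStrings m)} :
    (blockHom m g).perm = 1 ↔ (crossings _ g).perm = 1 := by
  simp [blockHom_perm, Equiv.Perm.ext_iff, (strand m).symm.forall_congr_left, Equiv.symm_apply_eq]

theorem blockHom_cr_of_perm_eq_one {g : BraidQuot (numStrings m)} (hg : (blockHom m g).perm = 1)
    (e : Sym2 (Point m)) : (blockHom m g).cr e = (crossings _ g).cr (e.map (strand m)) := by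
  simp [blockHom_cr, hg]

theorem two_dvd_blockHom_cr {g : BraidQuot (numStrings m)} (hg : (blockHom m g).perm = 1)
    {e : Sym2 (Point m)} (he : ¬e.IsDiag) : 2 ∣ (blockHom m g).cr e := by
  induction e with | _ P Q
  rw [blockHom_cr_of_perm_eq_one hg]
  exact two_dvd_crossings (blockHom_perm_eq_one_iff.1 hg)
    ((strand m).injective.ne (by simpa using he))

theorem eq_one_of_blockHom {g : BraidQuot (numStrings m)} (hg : (blockHom m g).perm = 1)
    (h : ∀ e, ¬e.IsDiag → (blockHom m g).cr e = 0) : g = 1 := by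
  refine eq_one_of_crossings (blockHom_perm_eq_one_iff.1 hg) fun x y hxy => ?_
  have := h s((strand m).symm x, (strand m).symm y) (by simpa using hxy)
  simpa [blockHom_cr_of_perm_eq_one hg] using this

theorem blockHom_injective : Function.Injective (blockHom m) :=
  (injective_iff_map_eq_one _).2 fun g h => eq_one_of_blockHom (by simp [h]) (by simp [h])

theorem blockHom_pureA {P Q : Point m} (h : strand m P < strand m Q) :
    blockHom m (pureA _ (strand m P + 1) (strand m Q + 1)) = ⟨1, Pi.single s(P, Q) 2⟩ := by
  have hperm : (blockHom m (pureA _ (strand m P + 1) (strand m Q + 1))).perm = 1 := by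
    rw [blockHom_perm_eq_one_iff, crossings_pureA h]
  refine CrossingGroup.ext hperm (funext fun e => ?_)
  have hinj := (Sym2.map.injective (strand m).injective).eq_iff (a := e) (b := s(P, Q))
  rw [Sym2.map_mk] at hinj
  simp only [blockHom_cr_of_perm_eq_one hperm, crossings_pureA h, Pi.single_apply, hinj]

theorem deltaBlock_cr_add_blockTwist {j : Fin t} (hj : Odd (m j)) {P Q : Point m}
    (hPQ : strand m P ≤ strand m Q) :
    (crossings _ (deltaBlock _ (blockStart m j) (m j))).cr s(strand m P, strand m Q) +
      blockTwist m s(P, Q) =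
        blockTwist m s(shift (-Pi.single j 1) P, shift (-Pi.single j 1) Q) := by
  have ⟨c, hc⟩ := hj
  rw [deltaBlock_cr_strand hj hPQ]
  obtain ⟨i, u⟩ := P
  obtain ⟨l, v⟩ := Q
  simp only [blockTwist, Sym2.lift_mk, shift_apply, Sigma.mk.injEq, Pi.neg_apply]
  obtain rfl | hil := eq_or_ne i l
  · obtain rfl | hij := eq_or_ne i j
    · have := u.val_lt
      have := v.val_lt
      have := zmod_val_sub_one u
      have := zmod_val_sub_one v
      have := ZMod.val_eq_zero u
      have := ZMod.val_eq_zero v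
      simp only [Fin.le_def, strand_val] at hPQ
      simp only [Pi.single_eq_same, ← sub_eq_add_neg]
      grind
    · simp [hij]
  · have : ¬(i = j ∧ l = j) := fun h => hil (h.1.trans h.2.symm)
    grind

theorem blockHom_deltaBlock {j : Fin t} (hj : Odd (m j)) :
    blockHom m (deltaBlock _ (blockStart m j) (m j)) = ⟨shift (-Pi.single j 1), 0⟩ := by
  have hperm : (blockHom m (deltaBlock _ (blockStart m j) (m j))).perm =
      shift (-Pi.single j 1) := by
    ext P : 1
    simp [blockHom_perm, deltaBlock_perm_strand hj]
  refine CrossingGroup.ext hperm (funext fun e => ?_)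
  rw [blockHom_cr, hperm]
  induction e with | _ P Q
  rcases le_total (strand m P) (strand m Q) with h | h
  · simp [deltaBlock_cr_add_blockTwist hj h]
  · rw [Sym2.eq_swap]
    simp [deltaBlock_cr_add_blockTwist hj h]

theorem blockHom_list_ofFn_prod_perm {f : Fin t → BraidQuot (numStrings m)}
    (hf : ∀ j, (blockHom m (f j)).perm = shift (-Pi.single j 1)) :
    (blockHom m (List.ofFn f).prod).perm = shift (-1) := by
  rw [← permHom_apply, ← MonoidHom.comp_apply, map_list_prod, List.map_ofFn,
    show ((permHom _).comp (blockHom m)) ∘ f = shift ∘ fun j => -Pi.single j 1 from funext hf,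
    ← List.map_ofFn, list_map_shift_prod, List.sum_ofFn, Finset.sum_neg_distrib]
  exact congrArg (fun w => shift (-w)) (Finset.univ_sum_single (1 : ∀ j, ZMod (m j)))

theorem blockHom_deltaAll_perm (hodd : ∀ j, Odd (m j)) :
    (blockHom m (deltaAll m)).perm = shift (-1) :=
  blockHom_list_ofFn_prod_perm fun j => congrArg perm (blockHom_deltaBlock (hodd j))

theorem blockHom_deltaAll_pow_perm (hodd : ∀ j, Odd (m j)) (k : ℕ) :
    (blockHom m (deltaAll m ^ k)).perm = (shift k)⁻¹ := by
  rw [map_pow, pow_perm, blockHom_deltaAll_perm hodd, ← shift_nsmul, ← shift_neg, smul_neg,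
    nsmul_one]

end BlockHom

/-! ### Orbits of pairs of strings under translations -/

section Orbits

variable {t : ℕ} {m : Fin t → ℕ}

/-- The two blocks and the distance between the positions of a representative of an orbit. -/
def orbitCode : OrbitIndex m → Fin t × Fin t × ℕ
  | Sum.inl j => (j, j, 1)
  | Sum.inr (Sum.inl x) => (x.1, x.1, x.2 + 1)
  | Sum.inr (Sum.inr x) => (x.1.1, x.1.2, 0)

variable (m) in
/-- The triples of the form `orbitCode i`: two strings of one block at distance less than half the
block size, or the first strings of two blocks. -/
def IsOrbitCode : Fin t × Fin t × ℕ → Prop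
  | (j, l, d) => j = l ∧ 0 < d ∧ 2 * d < m j ∨ j < l ∧ d = 0

/-- The pair of strings representing the orbit with code `c`. -/
def codeRep (c : Fin t × Fin t × ℕ) : Sym2 (Point m) := s(⟨c.1, 0⟩, ⟨c.2.1, c.2.2⟩)

theorem isOrbitCode_orbitCode (hm : ∀ j, 2 < m j) (i : OrbitIndex m) :
    IsOrbitCode m (orbitCode i) := by
  rcases i with j | ⟨j, h, hh⟩ | ⟨x, hx⟩
  · exact Or.inl ⟨rfl, one_pos, hm j⟩
  · rw [Finset.mem_Icc] at hh
    refine Or.inl ⟨rfl, Nat.succ_pos _, ?_⟩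
    simp only
    omega
  · exact Or.inr ⟨hx, rfl⟩

theorem orbitCode_injective : Function.Injective (orbitCode (m := m)) := by
  rintro (j | ⟨j, h, hh⟩ | ⟨x, hx⟩) (j' | ⟨j', h', hh'⟩ | ⟨x', hx'⟩) e <;>
    simp only [orbitCode, Prod.mk.injEq] at e <;> grind

theorem exists_orbitCode_eq {c : Fin t × Fin t × ℕ} (hc : IsOrbitCode m c) :
    ∃ i : OrbitIndex m, orbitCode i = c := by
  obtain ⟨j, l, d⟩ := c
  rcases hc with ⟨rfl, hd, hdm⟩ | ⟨hjl, rfl⟩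
  · obtain rfl | hd₁ := eq_or_ne d 1
    · exact ⟨Sum.inl j, rfl⟩
    · refine ⟨Sum.inr (Sum.inl ⟨j, d - 1, Finset.mem_Icc.2 ?_⟩), ?_⟩
      · omega
      · simp only [orbitCode, Prod.mk.injEq, true_and]
        omega
  · exact ⟨Sum.inr (Sum.inr ⟨(j, l), hjl⟩), rfl⟩

theorem zmod_natCast_inj {k a b : ℕ} (ha : a < k) (hb : b < k) :
    (a : ZMod k) = b ↔ a = b := by
  rw [ZMod.natCast_eq_natCast_iff', Nat.mod_eq_of_lt ha, Nat.mod_eq_of_lt hb]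

theorem codeRep_not_isDiag {c : Fin t × Fin t × ℕ} (hc : IsOrbitCode m c) :
    ¬(codeRep c : Sym2 (Point m)).IsDiag := by
  obtain ⟨j, l, d⟩ := c
  rcases hc with ⟨rfl, hd, hdm⟩ | ⟨hjl, -⟩
  · have := (zmod_natCast_inj (a := 0) (b := d) (by omega : 0 < m j) (by omega)).not.2 hd.ne
    simpa [codeRep] using this
  · simp [codeRep, hjl.ne]

theorem codeRep_map_shift_eq_iff {c c' : Fin t × Fin t × ℕ} (hc : IsOrbitCode m c)
    (hc' : IsOrbitCode m c') (w : ∀ j, ZMod (m j)) :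
    (codeRep c).map (shift w) = codeRep c' ↔ c = c' ∧ w c.1 = 0 ∧ w c.2.1 = 0 := by
  obtain ⟨j, l, d⟩ := c
  obtain ⟨j', l', d'⟩ := c'
  simp only [codeRep, Sym2.map_mk, shift_apply, Sym2.eq_iff, zero_add, Sigma.mk.injEq,
    Prod.mk.injEq]
  constructor
  · rintro (⟨⟨rfl, hj⟩, rfl, hl⟩ | ⟨⟨rfl, hj⟩, rfl, hl⟩)
    · rw [heq_iff_eq] at hj hl
      obtain ⟨rfl, hd, hdm⟩ | ⟨hjl, rfl⟩ := hc
      · obtain ⟨-, -, hdm'⟩ | ⟨h, -⟩ := hc'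
        · rw [hj, add_zero, zmod_natCast_inj (by omega) (by omega)] at hl
          exact ⟨⟨rfl, rfl, hl⟩, hj, hj⟩
        · exact absurd h (lt_irrefl _)
      · obtain ⟨h, -⟩ | ⟨-, rfl⟩ := hc'
        · exact absurd h hjl.ne
        · exact ⟨⟨rfl, rfl, rfl⟩, hj, by simpa using hl⟩
    · obtain ⟨rfl, hd, hdm⟩ | ⟨hjl, -⟩ := hc
      · obtain ⟨-, -, hdm'⟩ | ⟨h, -⟩ := hc'
        · rw [heq_iff_eq] at hj hl
          rw [hj, ← Nat.cast_add, ← Nat.cast_zero,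
            zmod_natCast_inj (by omega) (by omega)] at hl
          omega
        · exact absurd h (lt_irrefl _)
      · obtain ⟨h, -⟩ | ⟨h, -⟩ := hc'
        · exact absurd h hjl.ne'
        · exact absurd h hjl.asymm
  · rintro ⟨⟨rfl, rfl, rfl⟩, hj, hl⟩
    simp [hj, hl]

theorem exists_codeRep_map_shift_eq (hodd : ∀ j, Odd (m j)) {e : Sym2 (Point m)} (he : ¬e.IsDiag) :
    ∃ (i : OrbitIndex m) (w : ∀ j, ZMod (m j)), (codeRep (orbitCode i)).map (shift w) = e := by
  suffices h : ∃ c, IsOrbitCode m c ∧ ∃ w : ∀ j, ZMod (m j), (codeRep c).map (shift w) = e by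
    obtain ⟨c, hc, hw⟩ := h
    obtain ⟨i, rfl⟩ := exists_orbitCode_eq hc
    exact ⟨i, hw⟩
  induction e with | _ P Q
  obtain ⟨j, u⟩ := P
  obtain ⟨l, v⟩ := Q
  wlog hjl : j ≤ l generalizing j l u v
  · rw [Sym2.eq_swap] at he ⊢
    exact this l v j u he (le_of_not_ge hjl)
  obtain rfl | hlt := hjl.eq_or_lt
  · have hne : v - u ≠ 0 := sub_ne_zero.2 fun h => he (by simp [h])
    obtain ⟨c, hc⟩ := hodd j
    have : NeZero (m j) := ⟨by omega⟩
    have hd : IsOrbitCode m (j, j, (v - u).valMinAbs.natAbs) :=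
      Or.inl ⟨rfl, Int.natAbs_pos.2 (by simpa using hne),
        by have := ZMod.natAbs_valMinAbs_le (v - u); omega⟩
    refine ⟨_, hd, ?_⟩
    rcases Int.natAbs_eq (v - u).valMinAbs with h | h
    · have hv : ((v - u).valMinAbs.natAbs : ZMod (m j)) = v - u := by
        rw [← Int.cast_natCast, ← h, ZMod.coe_valMinAbs]
      exact ⟨Pi.single j u, by simp [codeRep, shift_apply, hv]⟩
    · have hu : ((v - u).valMinAbs.natAbs : ZMod (m j)) = u - v := by
        rw [← Int.cast_natCast, ← neg_eq_iff_eq_neg.2 h, Int.cast_neg, ZMod.coe_valMinAbs, neg_sub]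
      exact ⟨Pi.single j v, by simp [codeRep, shift_apply, hu]⟩
  · refine ⟨(j, l, 0), Or.inr ⟨hlt, rfl⟩, Pi.single j u + Pi.single l v, ?_⟩
    simp [codeRep, shift_apply, hlt.ne, hlt.ne']

end Orbits

theorem existsUnique_lt_natCast_eq {R : Type*} [NonAssocSemiring R] {k : ℕ} [NeZero k]
    (f : ZMod k ≃+* R) (y : R) : ∃! i : ℕ, i < k ∧ (i : R) = y := by
  refine ⟨(f.symm y).val, ⟨ZMod.val_lt _, ?_⟩, fun i ⟨hi, hy⟩ => ?_⟩
  · rw [← map_natCast f, ZMod.natCast_val, ZMod.cast_id', id, f.apply_symm_apply]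
  · rw [← hy, map_natCast, ZMod.val_natCast_of_lt hi]

section OrbitSingle

variable {t : ℕ} {m : Fin t → ℕ}

open Classical in
/-- The function equal to `a` on the orbit of `codeRep c` under all translations and to `0`
elsewhere. -/
noncomputable def orbitSingle (c : Fin t × Fin t × ℕ) (a : ℤ) (e : Sym2 (Point m)) : ℤ :=
  if ∃ w : ∀ j, ZMod (m j), e.map (shift w) = codeRep c then a else 0

theorem map_shift_map_shift (e : Sym2 (Point m)) (w w' : ∀ j, ZMod (m j)) :
    (e.map (shift w)).map (shift w') = e.map (shift (w + w')) := by
  rw [Sym2.map_map, ← Equiv.Perm.coe_mul, ← shift_add, add_comm]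

theorem orbitSingle_map_shift (c : Fin t × Fin t × ℕ) (a : ℤ) (w : ∀ j, ZMod (m j))
    (e : Sym2 (Point m)) : orbitSingle c a (e.map (shift w)) = orbitSingle c a e := by
  rw [orbitSingle, orbitSingle]
  congr 1
  refine propext ⟨fun ⟨w', h⟩ => ⟨w + w', ?_⟩, fun ⟨w', h⟩ => ⟨w' - w, ?_⟩⟩
  · rwa [← map_shift_map_shift]
  · rwa [map_shift_map_shift, add_sub_cancel]

theorem orbitSingle_codeRep {c c' : Fin t × Fin t × ℕ} (hc : IsOrbitCode m c)
    (hc' : IsOrbitCode m c') (a : ℤ) :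
    orbitSingle c a (codeRep c' : Sym2 (Point m)) = if c' = c then a else 0 := by
  rw [orbitSingle]
  congr 1
  simp only [codeRep_map_shift_eq_iff hc' hc]
  exact propext ⟨fun ⟨_, h, _⟩ => h, fun h => ⟨0, h, rfl, rfl⟩⟩

theorem sum_single_map_shift {c : Fin t × Fin t × ℕ} (hc : IsOrbitCode m c)
    {v : ∀ j, ZMod (m j)} {N : ℕ}
    (hN : ∀ w : ∀ j, ZMod (m j), ∃! k, k < N ∧ k • v c.1 = w c.1 ∧ k • v c.2.1 = w c.2.1) (a : ℤ)
    (e : Sym2 (Point m)) :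
    ∑ k ∈ Finset.range N, (Pi.single (codeRep c) a : Sym2 (Point m) → ℤ) (e.map (shift (k • v))) =
      orbitSingle c a e := by
  simp only [Pi.single_apply, orbitSingle]
  split_ifs with h
  · obtain ⟨w, hw⟩ := h
    have hiff (k : ℕ) : e.map (shift (k • v)) = codeRep c ↔
        k • v c.1 = w c.1 ∧ k • v c.2.1 = w c.2.1 := by
      rw [show k • v = w + (k • v - w) from (add_sub_cancel _ _).symm, ← map_shift_map_shift, hw,
        codeRep_map_shift_eq_iff hc hc]
      simp [sub_eq_zero]
    obtain ⟨k, ⟨hk, hkw⟩, huniq⟩ := hN w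
    rw [Finset.sum_eq_single_of_mem k (Finset.mem_range.2 hk), if_pos ((hiff k).2 hkw)]
    exact fun i hi hik => if_neg fun h => hik (huniq i ⟨Finset.mem_range.1 hi, (hiff i).1 h⟩)
  · exact Finset.sum_eq_zero fun k _ => if_neg fun hk => h ⟨_, hk⟩

end OrbitSingle

section OrbitProd

variable {t : ℕ} {m : Fin t → ℕ} [∀ j, NeZero (m j)]

theorem blockHom_pureA_codeRep {c : Fin t × Fin t × ℕ} (hc : IsOrbitCode m c) :
    blockHom m (pureA _ (blockStart m c.1 + 1) (blockStart m c.2.1 + c.2.2 + 1)) =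
      ⟨1, Pi.single (codeRep c) 2⟩ := by
  obtain ⟨j, l, d⟩ := c
  have hd : d < m l := by
    obtain ⟨rfl, -, h⟩ | ⟨-, rfl⟩ := hc
    · omega
    · exact NeZero.pos _
  have hl : (strand m ⟨l, d⟩ : ℕ) = blockStart m l + d := by
    rw [strand_val, ZMod.val_natCast_of_lt hd]
  have hj : (strand m ⟨j, 0⟩ : ℕ) = blockStart m j := by
    rw [strand_val, ZMod.val_zero, add_zero]
  have hlt : strand m ⟨j, 0⟩ < strand m ⟨l, d⟩ := by
    obtain ⟨rfl, h, -⟩ | ⟨h, -⟩ := hc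
    · rw [Fin.lt_def]
      omega
    · exact strand_lt_strand h
  have := blockHom_pureA hlt
  rwa [hl, hj] at this

theorem blockHom_blockGen {j : Fin t} (hj : Odd (m j)) (hm : 2 < m j) :
    blockHom m (blockGen m j) = ⟨1, Pi.single (codeRep (j, j, 1)) 2⟩ *
      ⟨shift (-Pi.single j 1), 0⟩ := by
  have hc : IsOrbitCode m (j, j, 1) := Or.inl ⟨rfl, one_pos, hm⟩
  rw [blockGen, map_mul, blockHom_deltaBlock hj, ← blockHom_pureA_codeRep hc]

theorem blockHom_eFixed {j : Fin t} (hj : Odd (m j)) (hm : 2 < m j) :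
    blockHom m (eFixed m j) = ⟨1, orbitSingle (j, j, 1) 2⟩ := by
  have hc : IsOrbitCode m (j, j, 1) := Or.inl ⟨rfl, one_pos, hm⟩
  set v : ∀ l, ZMod (m l) := -Pi.single j 1 with hv
  have hgen := blockHom_blockGen hj hm
  have hperm : (blockHom m (blockGen m j)).perm = shift v := by rw [hgen, mul_perm, one_mul]
  rw [eFixed, map_pow]
  refine CrossingGroup.ext ?_ (funext fun e => ?_)
  · have : m j • v = 0 := by
      rw [hv, smul_neg, ← Pi.single_smul, nsmul_one, CharP.cast_eq_zero, Pi.single_zero, neg_zero]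
    rw [pow_perm, hperm, ← shift_nsmul, this, shift_zero]
  · have hterm (i : ℕ) : (blockHom m (blockGen m j)).cr (e.map (shift (i • v))) =
        (Pi.single (codeRep (j, j, 1)) 2 : Sym2 (Point m) → ℤ)
          ((e.map (shift v)).map (shift (i • v))) := by
      rw [hgen, mul_cr, map_shift_map_shift, map_shift_map_shift, add_comm v]
      exact add_zero (M := ℤ) _
    simp only [pow_cr, hperm, ← shift_nsmul, hterm]
    rw [sum_single_map_shift hc, orbitSingle_map_shift]
    intro w
    convert existsUnique_lt_natCast_eq (RingEquiv.refl (ZMod (m j))) (-w j) using 3 with i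
    simp [hv, neg_eq_iff_eq_neg]

theorem blockHom_conj_deltaAll_pow (hodd : ∀ j, Odd (m j)) {g : BraidQuot (numStrings m)}
    (hg : (blockHom m g).perm = 1) (k : ℕ) :
    blockHom m (deltaAll m ^ k * g * (deltaAll m ^ k)⁻¹) =
      ⟨1, fun e => (blockHom m g).cr (e.map (shift k))⟩ := by
  rw [map_mul, map_mul, map_inv]
  refine CrossingGroup.ext (conj_perm hg _) (funext fun e => ?_)
  rw [conj_cr hg, blockHom_deltaAll_pow_perm hodd, inv_inv]

theorem blockHom_conj_prod (hodd : ∀ j, Odd (m j)) {c : Fin t × Fin t × ℕ} (hc : IsOrbitCode m c)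
    {N : ℕ} (hN : ∀ w : ∀ j, ZMod (m j), ∃! k : ℕ, k < N ∧ k = w c.1 ∧ k = w c.2.1) :
    blockHom m ((List.range' 1 N).map fun k => deltaAll m ^ (k - 1) *
      pureA _ (blockStart m c.1 + 1) (blockStart m c.2.1 + c.2.2 + 1) ^ holonomyOrder m *
        (deltaAll m ^ (k - 1))⁻¹).prod = ⟨1, orbitSingle c (2 * holonomyOrder m)⟩ := by
  have hA : blockHom m (pureA _ (blockStart m c.1 + 1) (blockStart m c.2.1 + c.2.2 + 1) ^
      holonomyOrder m) = ⟨1, Pi.single (codeRep c) (2 * holonomyOrder m)⟩ := by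
    rw [map_pow, blockHom_pureA_codeRep hc, mk_single_pow]
  have hconj (k : ℕ) := blockHom_conj_deltaAll_pow hodd (congrArg perm hA) k
  simp only [hA] at hconj
  rw [map_list_prod, List.range'_eq_map_range, List.map_map, List.map_map]
  simp only [Function.comp_def, add_tsub_cancel_left, hconj]
  rw [list_range_map_prod]
  refine CrossingGroup.ext rfl (funext fun e => ?_)
  simp only [← nsmul_one (A := ∀ j, ZMod (m j))]
  refine sum_single_map_shift hc (fun w => ?_) _ e
  simpa only [Pi.one_apply, nsmul_one] using hN w

/-- The nonzero value of the crossing numbers of `orbitProd m i`. -/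
def orbitWeight (m : Fin t → ℕ) : OrbitIndex m → ℤ
  | Sum.inl _ => 2
  | Sum.inr _ => 2 * holonomyOrder m

theorem blockHom_orbitProd (hodd : ∀ j, Odd (m j)) (hm : ∀ j, 2 < m j)
    (hco : Pairwise (Function.onFun Nat.Coprime m)) (i : OrbitIndex m) :
    blockHom m (orbitProd m i) = ⟨1, orbitSingle (orbitCode i) (orbitWeight m i)⟩ := by
  have hi := isOrbitCode_orbitCode hm i
  rcases i with j | x | ⟨⟨j, l⟩, hjl⟩
  · exact blockHom_eFixed (hodd j) (hm j)
  · refine blockHom_conj_prod hodd hi fun w => ?_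
    change ∃! k : ℕ, k < m x.1 ∧ k = w x.1 ∧ k = w x.1
    simp only [and_self]
    exact existsUnique_lt_natCast_eq (RingEquiv.refl (ZMod (m x.1))) (w x.1)
  · refine blockHom_conj_prod hodd hi fun w => ?_
    change ∃! k : ℕ, k < m j * m l ∧ k = w j ∧ k = w l
    have := existsUnique_lt_natCast_eq (ZMod.chineseRemainder (hco hjl.ne)) (w j, w l)
    simpa only [Prod.ext_iff, Prod.fst_natCast, Prod.snd_natCast] using this

end OrbitProd

/-! ### The group `Γ_q` and its center -/

section Gamma

variable {t : ℕ} {m : Fin t → ℕ}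

variable (m) in
/-- The subgroup of the elements that permute the strings by a translation and whose crossing
numbers are multiples of `k` on all pairs of strings, except for pairs of strings that are adjacent
in the cyclic order of a block. -/
def translationSubgroup (k : ℤ) : Subgroup (CrossingGroup (Point m)) where
  carrier := {g | (∃ w, g.perm = shift w) ∧
    ∀ e, (∀ j, orbitSingle (j, j, 1) 1 e = 0) → k ∣ g.cr e}
  one_mem' := ⟨⟨0, shift_zero.symm⟩, fun _ _ => dvd_zero k⟩
  mul_mem' := by
    rintro g h ⟨⟨w, hw⟩, hg⟩ ⟨⟨w', hw'⟩, hh⟩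
    refine ⟨⟨w + w', by rw [mul_perm, hw, hw', shift_add]⟩, fun e he => ?_⟩
    rw [mul_cr, hw']
    exact dvd_add (hg _ fun j => by rw [orbitSingle_map_shift, he]) (hh e he)
  inv_mem' := by
    rintro g ⟨⟨w, hw⟩, hg⟩
    refine ⟨⟨-w, by rw [inv_perm, hw, shift_neg]⟩, fun e he => ?_⟩
    rw [inv_cr, hw, ← shift_neg]
    exact (hg _ fun j => by rw [orbitSingle_map_shift, he]).neg_right

variable [∀ j, NeZero (m j)]

theorem blockHom_commute_iff {g : BraidQuot (numStrings m)} (hg : (blockHom m g).perm = 1)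
    (h : BraidQuot (numStrings m)) :
    Commute h g ↔ ∀ e, (blockHom m g).cr (e.map (blockHom m h).perm) = (blockHom m g).cr e :=
  (commute_map_iff blockHom_injective).symm.trans (commute_iff hg _)

theorem GammaQ_le_translationSubgroup (hodd : ∀ j, Odd (m j)) (hm : ∀ j, 2 < m j) :
    GammaQ m ≤ (translationSubgroup m (2 * holonomyOrder m)).comap (blockHom m) := by
  refine (Subgroup.closure_le _).2 (Set.union_subset ?_ ?_)
  · rintro _ ⟨j, rfl⟩
    have hc : IsOrbitCode m (j, j, 1) := Or.inl ⟨rfl, one_pos, hm j⟩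
    rw [SetLike.mem_coe, Subgroup.mem_comap, blockHom_blockGen (hodd j) (hm j)]
    refine ⟨⟨_, one_mul _⟩, fun e he => ?_⟩
    have hne : e.map (shift (-Pi.single j 1)) ≠ codeRep (j, j, 1) := fun h => by
      have := he j
      rw [← orbitSingle_map_shift _ _ (-Pi.single j 1), h, orbitSingle_codeRep hc hc] at this
      exact one_ne_zero (this.symm.trans (if_pos rfl)).symm
    simp [Pi.single_eq_of_ne hne]
  · rintro _ ⟨r, s, hr, hrs, hs, rfl⟩
    obtain ⟨P, hP⟩ := (strand m).surjective ⟨r - 1, by omega⟩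
    obtain ⟨Q, hQ⟩ := (strand m).surjective ⟨s - 1, by omega⟩
    obtain rfl : r = strand m P + 1 := by rw [hP]; exact (Nat.sub_add_cancel hr).symm
    obtain rfl : s = strand m Q + 1 := by rw [hQ]; exact (Nat.sub_add_cancel (by omega)).symm
    rw [SetLike.mem_coe, Subgroup.mem_comap, map_pow, blockHom_pureA (by omega), mk_single_pow]
    refine ⟨⟨0, shift_zero.symm⟩, fun e _ => ?_⟩
    obtain rfl | he := eq_or_ne e s(P, Q) <;> simp [*]

theorem exists_mem_GammaQ_blockHom_eq {e : Sym2 (Point m)} (he : ¬e.IsDiag) :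
    ∃ g ∈ GammaQ m, blockHom m g = ⟨1, Pi.single e (2 * holonomyOrder m)⟩ := by
  induction e with | _ P Q
  wlog h : strand m P < strand m Q generalizing P Q
  · rw [Sym2.eq_swap] at he ⊢
    refine this Q P he ((not_lt.1 h).lt_of_ne ((strand m).injective.ne ?_))
    simpa using he
  · refine ⟨_, Subgroup.subset_closure (Or.inr ⟨strand m P + 1, strand m Q + 1, by omega, by omega,
      by omega, rfl⟩), ?_⟩
    rw [map_pow, blockHom_pureA h, mk_single_pow]

theorem exists_mem_GammaQ_perm_eq (hodd : ∀ j, Odd (m j)) (hm : ∀ j, 2 < m j) :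
    ∃ g ∈ GammaQ m, (blockHom m g).perm = shift (-1) := by
  refine ⟨(List.ofFn (blockGen m)).prod, Subgroup.list_prod_mem _ ?_,
    blockHom_list_ofFn_prod_perm fun j => ?_⟩
  · simp only [List.forall_mem_ofFn_iff]
    exact fun j => Subgroup.subset_closure (Or.inl ⟨j, rfl⟩)
  · rw [blockHom_blockGen (hodd j) (hm j), mul_perm, one_mul]

end Gamma

theorem perm_eq_one_of_map_eq {α : Type*} {π : Equiv.Perm α}
    (hα : ∀ x : α, ∃ y z, y ≠ x ∧ z ≠ x ∧ y ≠ z) (h : ∀ e : Sym2 α, ¬e.IsDiag → e.map π = e) :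
    π = 1 := by
  ext x
  obtain ⟨y, z, hy, hz, hyz⟩ := hα x
  have h₁ := h s(x, y) (by simpa using hy.symm)
  have h₂ := h s(x, z) (by simpa using hz.symm)
  simp only [Sym2.map_mk, Sym2.eq_iff] at h₁ h₂
  rw [Equiv.Perm.one_apply]
  grind

theorem exists_basis_of_dual {R M ι : Type*} [CommRing R] [NoZeroDivisors R] [AddCommGroup M]
    [Module R M] [Finite ι] [DecidableEq ι] {v : ι → M} {f : ι → M →ₗ[R] R} {a : ι → R}
    (ha : ∀ i, a i ≠ 0) (hv : ∀ i k, f k (v i) = if k = i then a i else 0)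
    (hdvd : ∀ i x, a i ∣ f i x) (hf : ∀ x, (∀ i, f i x = 0) → x = 0) :
    ∃ b : Module.Basis ι R M, ∀ i, b i = v i := by
  have := Fintype.ofFinite ι
  have hsum (c : ι → R) (k : ι) : f k (∑ i, c i • v i) = c k * a k := by
    simp [hv]
  have hli : LinearIndependent R v := Fintype.linearIndependent_iff.2 fun c hc k => by
    have := hsum c k
    rw [hc, map_zero, eq_comm] at this
    exact (mul_eq_zero.1 this).resolve_right (ha k)
  have hspan : ⊤ ≤ Submodule.span R (Set.range v) := fun x _ => by
    choose c hc using fun i => hdvd i x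
    obtain rfl : x = ∑ i, c i • v i := sub_eq_zero.1 <| hf _ fun k => by
      rw [map_sub, hsum, hc, mul_comm, sub_self]
    exact Submodule.sum_mem _ fun i _ => Submodule.smul_mem _ _ (Submodule.subset_span ⟨i, rfl⟩)
  exact ⟨Module.Basis.mk hli hspan, Module.Basis.mk_apply hli hspan⟩

theorem card_lt_pairs (t : ℕ) :
    Fintype.card {x : Fin t × Fin t // x.1 < x.2} = t * (t - 1) / 2 := by
  rw [Fintype.card_subtype, Finset.card_filter, Fintype.sum_prod_type_right]
  simp only [← Finset.card_filter]
  have (l : Fin t) : (Finset.univ.filter fun j => j < l).card = l := by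
    rw [Finset.filter_gt_eq_Iio, Fin.card_Iio]
  simp only [this]
  rw [Fin.sum_univ_eq_sum_range (fun i => i), Finset.sum_range_id]

section Center

variable {t : ℕ} {m : Fin t → ℕ}

theorem card_orbitIndex (hm : ∀ j, 2 < m j) :
    Fintype.card (OrbitIndex m) = (∑ j, (m j - 1) / 2) + t * (t - 1) / 2 := by
  have hsum : ∑ j, (m j - 1) / 2 = t + ∑ j, (m j - 3) / 2 := by
    have (j : Fin t) : (m j - 1) / 2 = 1 + (m j - 3) / 2 := by
      have := hm j
      omega
    simp [this, Finset.sum_add_distrib]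
  rw [Fintype.card_sum, Fintype.card_sum, Fintype.card_sigma, card_lt_pairs, ← add_assoc, hsum]
  simp

variable [∀ j, NeZero (m j)]

theorem holonomyOrder_ne_zero : holonomyOrder m ≠ 0 :=
  Finset.prod_ne_zero_iff.2 fun j _ => NeZero.ne (m j)

theorem apply_map_shift {β : Type*} (hco : Pairwise (Function.onFun Nat.Coprime m))
    {f : Sym2 (Point m) → β} (hf : ∀ e, f (e.map (shift (-1))) = f e) (w : ∀ j, ZMod (m j))
    (e : Sym2 (Point m)) : f (e.map (shift w)) = f e := by
  have : NeZero (∏ j, m j) := ⟨holonomyOrder_ne_zero⟩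
  obtain ⟨k, ⟨-, hk⟩, -⟩ := existsUnique_lt_natCast_eq (ZMod.prodEquivPi m hco) (-w)
  obtain rfl : w = k • (-1) := by rw [smul_neg, nsmul_one, hk, neg_neg]
  clear hk
  induction k with
  | zero => simp [shift_zero]
  | succ k ih => rw [succ_nsmul, ← map_shift_map_shift, hf, ih]

theorem perm_eq_one_of_commute (hm : ∀ j, 2 < m j) {g : BraidQuot (numStrings m)}
    (hg : ∀ h ∈ GammaQ m, Commute g h) : (blockHom m g).perm = 1 := by
  refine perm_eq_one_of_map_eq (fun P => ?_) fun e he => ?_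
  · obtain ⟨j, u⟩ := P
    have h₁ : (1 : ZMod (m j)) ≠ 0 := by
      exact_mod_cast (zmod_natCast_inj (one_lt_two.trans (hm j)) (NeZero.pos _)).not.2 one_ne_zero
    have h₂ : (2 : ZMod (m j)) ≠ 0 := by
      exact_mod_cast (zmod_natCast_inj (hm j) (NeZero.pos _)).not.2 two_ne_zero
    have h₂₁ : (2 : ZMod (m j)) ≠ 1 := fun h => h₁ (by linear_combination h)
    exact ⟨⟨j, u + 1⟩, ⟨j, u + 2⟩, by simpa using h₁, by simpa using h₂, by simpa using h₂₁.symm⟩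
  · obtain ⟨h, hh, hhe⟩ := exists_mem_GammaQ_blockHom_eq he
    have hcr := (blockHom_commute_iff (congrArg perm hhe) g).1 (hg h hh) e
    simp only [hhe, Pi.single_apply, if_true] at hcr
    by_contra hne
    simp [hne, holonomyOrder_ne_zero] at hcr

theorem eq_one_of_commute (hodd : ∀ j, Odd (m j)) (hm : ∀ j, 2 < m j)
    (hco : Pairwise (Function.onFun Nat.Coprime m)) {g : BraidQuot (numStrings m)}
    (hg : ∀ h ∈ GammaQ m, Commute g h)
    (h₀ : ∀ i : OrbitIndex m, (blockHom m g).cr (codeRep (orbitCode i)) = 0) : g = 1 := by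
  have hperm := perm_eq_one_of_commute hm hg
  obtain ⟨d, hd, hd_perm⟩ := exists_mem_GammaQ_perm_eq hodd hm
  have hinv := (blockHom_commute_iff hperm d).1 (hg d hd).symm
  rw [hd_perm] at hinv
  refine eq_one_of_blockHom hperm fun e he => ?_
  obtain ⟨i, w, rfl⟩ := exists_codeRep_map_shift_eq hodd he
  rw [apply_map_shift hco hinv, h₀]

theorem orbitWeight_dvd (hodd : ∀ j, Odd (m j)) (hm : ∀ j, 2 < m j)
    {g : BraidQuot (numStrings m)} (hg : g ∈ GammaQ m) (hperm : (blockHom m g).perm = 1)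
    (i : OrbitIndex m) : orbitWeight m i ∣ (blockHom m g).cr (codeRep (orbitCode i)) := by
  have hi := isOrbitCode_orbitCode hm i
  rcases i with j | i
  · exact two_dvd_blockHom_cr hperm (codeRep_not_isDiag hi)
  · refine (GammaQ_le_translationSubgroup hodd hm hg).2 _ fun j => ?_
    have hj := isOrbitCode_orbitCode hm (Sum.inl j)
    refine (orbitSingle_codeRep hj hi 1).trans (if_neg fun h => ?_)
    exact Sum.inr_ne_inl (orbitCode_injective h)

theorem conj_pureA_pow_mem (hodd : ∀ j, Odd (m j)) (hm : ∀ j, 2 < m j)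
    {c : Fin t × Fin t × ℕ} (hc : IsOrbitCode m c) (k : ℕ) :
    deltaAll m ^ k * pureA _ (blockStart m c.1 + 1) (blockStart m c.2.1 + c.2.2 + 1) ^
      holonomyOrder m * (deltaAll m ^ k)⁻¹ ∈ GammaQ m := by
  obtain ⟨d, hd, hd_perm⟩ := exists_mem_GammaQ_perm_eq hodd hm
  obtain ⟨g, hg, hge⟩ := exists_mem_GammaQ_blockHom_eq (codeRep_not_isDiag hc)
  have hA : pureA _ (blockStart m c.1 + 1) (blockStart m c.2.1 + c.2.2 + 1) ^ holonomyOrder m = g :=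
    blockHom_injective (by rw [hge, map_pow, blockHom_pureA_codeRep hc, mk_single_pow])
  have hconj : deltaAll m ^ k * g * (deltaAll m ^ k)⁻¹ = d ^ k * g * (d ^ k)⁻¹ := by
    refine blockHom_injective ?_
    simp only [map_mul, map_inv]
    refine conj_eq_conj_of_perm_eq (congrArg perm hge) ?_
    simp only [map_pow, pow_perm, blockHom_deltaAll_perm hodd, hd_perm]
  rw [hA, hconj]
  exact mul_mem (mul_mem (pow_mem hd k) hg) (inv_mem (pow_mem hd k))

theorem orbitProd_mem (hodd : ∀ j, Odd (m j)) (hm : ∀ j, 2 < m j) (i : OrbitIndex m) :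
    orbitProd m i ∈ GammaQ m := by
  have hi := isOrbitCode_orbitCode hm i
  rcases i with j | x | x
  · exact (GammaQ m).pow_mem (Subgroup.subset_closure (Or.inl ⟨j, rfl⟩)) _
  all_goals
    exact Subgroup.list_prod_mem _ (List.forall_mem_map.2 fun k _ =>
      conj_pureA_pow_mem hodd hm hi (k - 1))

theorem commute_orbitProd (hodd : ∀ j, Odd (m j)) (hm : ∀ j, 2 < m j)
    (hco : Pairwise (Function.onFun Nat.Coprime m)) (i : OrbitIndex m)
    {h : BraidQuot (numStrings m)} (hh : h ∈ GammaQ m) : Commute h (orbitProd m i) := by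
  have hi := blockHom_orbitProd hodd hm hco i
  obtain ⟨w, hw⟩ := (GammaQ_le_translationSubgroup hodd hm hh).1
  refine (blockHom_commute_iff (congrArg perm hi) h).2 fun e => ?_
  rw [hi, hw]
  exact orbitSingle_map_shift _ _ w e

/-- The crossing number of a central element of `Γ_q` at a pair of strings. -/
def centerCr (hm : ∀ j, 2 < m j) (e : Sym2 (Point m)) :
    Additive (Subgroup.center (GammaQ m)) →+ ℤ where
  toFun g := (blockHom m g.toMul).cr e
  map_zero' := by simp
  map_add' g h := by
    have hh := perm_eq_one_of_commute hm fun x hx =>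
      congrArg Subtype.val (Subgroup.mem_center_iff.1 h.toMul.2 ⟨x, hx⟩).symm
    simp [hh]

theorem exists_center_basis (hodd : ∀ j, Odd (m j)) (hm : ∀ j, 2 < m j)
    (hco : Pairwise (Function.onFun Nat.Coprime m)) :
    ∃ b : Module.Basis (OrbitIndex m) ℤ (Additive (Subgroup.center (GammaQ m))),
      ∀ i, (((b i).toMul : GammaQ m) : BraidQuot (numStrings m)) = orbitProd m i := by
  have hcomm (g : Subgroup.center (GammaQ m)) (h) (hh : h ∈ GammaQ m) :
      Commute ((g : GammaQ m) : BraidQuot (numStrings m)) h :=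
    congrArg Subtype.val (Subgroup.mem_center_iff.1 g.2 ⟨h, hh⟩).symm
  let v (i : OrbitIndex m) : Additive (Subgroup.center (GammaQ m)) :=
    .ofMul ⟨⟨orbitProd m i, orbitProd_mem hodd hm i⟩, Subgroup.mem_center_iff.2 fun h =>
      Subtype.ext (commute_orbitProd hodd hm hco i h.2)⟩
  refine (exists_basis_of_dual (v := v) (a := orbitWeight m)
    (f := fun i => (centerCr hm (codeRep (orbitCode i))).toIntLinearMap) ?_ ?_ ?_ ?_).imp
      fun b hb i => by rw [hb]; rfl
  · rintro (_ | _)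
    · exact two_ne_zero
    · exact mul_ne_zero two_ne_zero (Nat.cast_ne_zero.2 holonomyOrder_ne_zero)
  · intro i k
    change (blockHom m (orbitProd m i)).cr (codeRep (orbitCode k)) = _
    rw [blockHom_orbitProd hodd hm hco]
    simpa only [orbitCode_injective.eq_iff] using
      orbitSingle_codeRep (isOrbitCode_orbitCode hm i) (isOrbitCode_orbitCode hm k) _
  · intro i g
    exact orbitWeight_dvd hodd hm g.toMul.1.2 (perm_eq_one_of_commute hm (hcomm g.toMul)) i
  · intro g hg
    exact Additive.toMul.injective (Subtype.ext (Subtype.ext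
      (eq_one_of_commute hodd hm hco (hcomm g.toMul) hg)))

end Center

theorem theorem4p3_general {t : ℕ} (m : Fin t → ℕ) (hodd : ∀ j, Odd (m j)) (hm : ∀ j, 1 < m j)
    (hco : Pairwise (Function.onFun Nat.Coprime m)) :
    Module.Free ℤ (Additive (Subgroup.center (GammaQ m))) ∧
    Module.Finite ℤ (Additive (Subgroup.center (GammaQ m))) ∧
    Module.finrank ℤ (Additive (Subgroup.center (GammaQ m))) =
      (∑ i, (m i - 1) / 2) + t * (t - 1) / 2 ∧
    ∃ b : Module.Basis (OrbitIndex m) ℤ (Additive (Subgroup.center (GammaQ m))),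
      ∀ x, (((b x).toMul : GammaQ m) : BraidQuot (numStrings m)) = orbitProd m x := by
  have (j : Fin t) : NeZero (m j) := ⟨(zero_lt_one.trans (hm j)).ne'⟩
  have hm₂ (j : Fin t) : 2 < m j := by
    obtain ⟨c, hc⟩ := hodd j
    have := hm j
    omega
  obtain ⟨b, hb⟩ := exists_center_basis hodd hm₂ hco
  exact ⟨.of_basis b, .of_basis b,
    by rw [Module.finrank_eq_card_basis b, card_orbitIndex hm₂], b, hb⟩

theorem theorem4p3 {t : ℕ} (p r : Fin t → ℕ) (hp : ∀ i, (p i).Prime) (hodd : ∀ i, Odd (p i))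
    (hinj : Function.Injective p) (hr : ∀ i, 1 ≤ r i) :
    Module.Free ℤ (Additive (Subgroup.center (GammaQ fun i => p i ^ r i))) ∧
    Module.Finite ℤ (Additive (Subgroup.center (GammaQ fun i => p i ^ r i))) ∧
    Module.finrank ℤ (Additive (Subgroup.center (GammaQ fun i => p i ^ r i))) =
      (∑ i, (p i ^ r i - 1) / 2) + t * (t - 1) / 2 ∧
    ∃ b : Module.Basis (OrbitIndex fun i => p i ^ r i) ℤ
        (Additive (Subgroup.center (GammaQ fun i => p i ^ r i))),
      ∀ x, (((b x).toMul : GammaQ fun i => p i ^ r i) : BraidQuot (numStrings fun i => p i ^ r i)) =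
        orbitProd (fun i => p i ^ r i) x :=
  theorem4p3_general _ (fun i => (hodd i).pow)
    (fun i => Nat.one_lt_pow (Nat.one_le_iff_ne_zero.1 (hr i)) (hp i).one_lt)
    fun i j hij => Nat.Coprime.pow _ _ ((Nat.coprime_primes (hp i) (hp j)).2 (hinj.ne hij))
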